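/- Let $[n]=\{1,\dots,n\}$. A family $\mathcal F\subseteq 2^{[n]}$ shatters a set $X\subseteq[n]$ if $\{F\cap X: F\in\mathcal F\}=2^X$, and its VC-dimension $VC(\mathcal F)$ is the largest size of a set shattered by $\mathcal F$. The family $\mathcal F\subseteq 2^{[n]}$ is called saturated if $VC(\mathcal F)<VC(\mathcal F')$ for every $\mathcal F'\subseteq 2^{[n]}$ with $\mathcal F'\supsetneq\mathcal F$, and $k$-saturated if it is saturated and $VC(\mathcal F)=k$. Let $sat_{VC}(n,k)$ denote the minimum size of a $k$-saturated family $\mathcal F\subseteq 2^{[n]}$. **Theorem.** For every integer $d\ge 3$ and every integer $n\ge 2d$, a $(d-1)$-saturated family $\mathcal F\subseteq 2^{[n]}$ exists and $$sat_{VC}(n,d-1)\le 4^d .$$ Moreover, if $d$ is odd or $d\ge 14$, then for every $n\ge 2d$ $$sat_{VC}(n,d-1)\le \frac12\binom{2d}{d}.$$ -/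

import Mathlib

/-- A family `F ⊆ 2^[n]` is saturated if every strictly larger family `F' ⊆ 2^[n]` has strictly
larger VC-dimension. -/
def IsSaturated {n : ℕ} (F : Finset (Finset (Fin n))) : Prop :=
  ∀ F' : Finset (Finset (Fin n)), F ⊂ F' → F.vcDim < F'.vcDim

/-- `F` is `k`-saturated if it is saturated and its VC-dimension equals `k`. -/
def IsKSaturated {n : ℕ} (k : ℕ) (F : Finset (Finset (Fin n))) : Prop :=
  IsSaturated F ∧ F.vcDim = k

/-- The saturation number: the minimum size of a `k`-saturated family `F ⊆ 2^[n]`.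
It takes values in `ℕ∞` and equals `⊤` if there is no such family, so that a finite upper bound
includes the existence of a `k`-saturated family. -/
noncomputable def satVC (n k : ℕ) : ℕ∞ :=
  ⨅ F : {F : Finset (Finset (Fin n)) // IsKSaturated k F}, (F.1.card : ℕ∞)

/-! The bounds do not depend on `n` because a large ground set arises from a small one by
duplicating a point. Let `F` shatter no `d`-set, and call a set forbidden if adding it to `F`
creates a shattered `d`-set. Suppose that for a point `v` no two non-forbidden sets differ exactly
in `v`. Pull `F` back to `[n]` along a map collapsing all additional points to `v`. A maximal family
of VC-dimension below `d` above this pullback is saturated. Read through a section of the map, each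
of its members is non-forbidden; a member separating two copies of `v` would give two non-forbidden
sets differing exactly in `v`. So all members are pullbacks of non-forbidden sets, which bounds
their number (`satVC_le_card_not_forbids`).

On a `2d`-set, take one `d`-set from each complementary pair. No `d`-set `X` is shattered, since the
traces `X` and `∅` would require both `X` and `Xᶜ`. If the choice is `Mixed`, all other traces on
every `X` are present, and each set outside the family is forbidden (`satVC_le_of_mixed`). It
remains to find mixed colorings that change under complementation.

For odd `d`, the parity of `A ∩ W` with `|W| = d` changes under complementation and is constant only
on slices with `Y = W` or `Y = Wᶜ`. Reversing it on the nontrivial transversals of a matching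
between `W` and `Wᶜ` breaks these slices and creates no new constant ones
(`mixed_transversalColoring`). For even `d ≥ 8`, write `d = 5 + e` with `e` odd and glue a
complement-invariant mixed coloring on 10 points to an antisymmetric one on `2e` points
(`IsGlued.mixed`). The 10-point coloring and the case `d = 6` are explicit tables checked by
evaluation. For `d = 4`, duplication is applied to an explicit family on 7 points. -/

/-! ### Saturated families by duplicating a point -/

section Duplication

variable {α β : Type*} [DecidableEq α] [DecidableEq β]

/-- `B` is forbidden for `F` if `F` together with `B` shatters a set of size `d`. -/
def Forbids (d : ℕ) (F : Finset (Finset α)) (B : Finset α) : Prop :=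
  ∃ X : Finset α, X.card = d ∧ (insert B F).Shatters X

/-- A pattern on `X \ {x}` extends to `X` in two ways, realised by two different members, and at
most one of these is `B`. -/
theorem Finset.Shatters.erase_of_insert {F : Finset (Finset α)} {B X : Finset α} {x : α}
    (h : (insert B F).Shatters X) (hx : x ∈ X) : F.Shatters (X.erase x) := by
  intro t ht
  have hxt : x ∉ t := fun h' => Finset.notMem_erase x X (ht h')
  have htX : t ⊆ X := ht.trans (Finset.erase_subset _ _)
  obtain ⟨u, hu, hut⟩ := h htX
  obtain ⟨w, hw, hwt⟩ := h (Finset.insert_subset hx htX)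
  have hxu : x ∉ u := fun h' => hxt (hut ▸ Finset.mem_inter.2 ⟨hx, h'⟩)
  have hxw : x ∈ w := (Finset.mem_inter.1 (hwt ▸ Finset.mem_insert_self x t)).2
  have key : ∀ u' : Finset α, X ∩ u' = t ∨ X ∩ u' = insert x t → X.erase x ∩ u' = t := by
    intro u' h'
    ext a
    have e1 : X ∩ u' = t → (a ∈ X ∧ a ∈ u' ↔ a ∈ t) := fun h => by
      rw [← h, Finset.mem_inter]
    have e2 : X ∩ u' = insert x t → (a ∈ X ∧ a ∈ u' ↔ a = x ∨ a ∈ t) := fun h => by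
      rw [← Finset.mem_insert, ← h, Finset.mem_inter]
    simp only [Finset.mem_inter, Finset.mem_erase]
    have hax : a = x → a ∉ t := fun h => h ▸ hxt
    rcases h' with h' | h'
    · have := e1 h'; tauto
    · have := e2 h'; tauto
  rcases Finset.mem_insert.1 hu with rfl | hu
  · rcases Finset.mem_insert.1 hw with rfl | hw
    · exact absurd hxw hxu
    · exact ⟨w, hw, key w (Or.inr hwt)⟩
  · exact ⟨u, hu, key u (Or.inl hut)⟩

/-- In the application `σ` is a section of the duplication map, and each `u` is some `w` read
through `σ`. -/
theorem Finset.Shatters.image_section {F : Finset (Finset α)} {G : Finset (Finset β)}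
    {X : Finset α} (σ : α → β) (h : F.Shatters X)
    (hFG : ∀ u ∈ F, ∃ w ∈ G, ∀ a, a ∈ u ↔ σ a ∈ w) : G.Shatters (X.image σ) := by
  intro t ht
  obtain ⟨u, hu, hut⟩ := h (Finset.filter_subset (fun a => σ a ∈ t) X)
  obtain ⟨w, hw, huw⟩ := hFG u hu
  refine ⟨w, hw, ?_⟩
  have key : ∀ a ∈ X, (σ a ∈ w ↔ σ a ∈ t) := fun a ha => by
    have := congrArg (a ∈ ·) hut
    simp only [Finset.mem_inter, Finset.mem_filter, ha, true_and, eq_iff_iff] at this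
    rw [← huw, this]
  ext b
  rw [Finset.mem_inter, Finset.mem_image]
  constructor
  · rintro ⟨⟨a, ha, rfl⟩, hb⟩
    exact (key a ha).1 hb
  · intro hb
    obtain ⟨a, ha, rfl⟩ := Finset.mem_image.1 (ht hb)
    exact ⟨⟨a, ha, rfl⟩, (key a ha).2 hb⟩

theorem Finset.vcDim_lt_of_not_shatters {F : Finset (Finset α)} {d : ℕ} (hd : 0 < d)
    (h : ∀ X : Finset α, X.card = d → ¬ F.Shatters X) : F.vcDim < d := by
  by_contra! hle
  obtain ⟨X, hX, hc⟩ : ∃ X ∈ F.shatterer, d ≤ X.card := by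
    by_contra! hlt
    have : F.vcDim < d := (Finset.sup_lt_iff hd).2 hlt
    omega
  obtain ⟨Y, hYX, hY⟩ := Finset.exists_subset_card_eq hc
  exact h Y hY ((Finset.mem_shatterer.1 hX).mono_right hYX)

variable [Fintype α]

open Classical in
/-- Duplicating a point `v` of the ground set turns a family on `α` into a saturated family on
`Fin n`, provided that no two non-forbidden sets differ exactly in `v`. -/
theorem satVC_le_card_not_forbids {d n : ℕ} (hd : 0 < d) (F : Finset (Finset α)) (v : α)
    (hn : Fintype.card α ≤ n) (hF : ∀ X : Finset α, X.card = d → ¬ F.Shatters X)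
    (hv : ∀ B, v ∉ B → Forbids d F B ∨ Forbids d F (insert v B)) :
    satVC n (d - 1) ≤ ((Finset.univ.filter fun B => ¬ Forbids d F B).card : ℕ∞) := by
  obtain ⟨e⟩ : Nonempty (α ↪ Fin n) := Function.Embedding.nonempty_of_card_le (by simpa using hn)
  -- Points outside the range of `e` are the additional copies of `v`.
  set π : Fin n → α := Function.extend e id (fun _ => v) with hπ
  have hπe : ∀ a, π (e a) = a := fun a => e.injective.extend_apply _ _ a
  have hπv : ∀ i, π i ≠ v → e (π i) = i := by
    intro i hi
    by_cases h : ∃ a, e a = i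
    · obtain ⟨a, rfl⟩ := h; rw [hπe]
    · exact absurd (Function.extend_apply' _ _ _ h) hi
  set pull : Finset α → Finset (Fin n) := fun A => Finset.univ.filter fun i => π i ∈ A with hpull
  have mem_pull : ∀ A i, i ∈ pull A ↔ π i ∈ A := fun A i => by simp [hpull]
  set F' := F.image pull with hF'
  have hF'd : F'.vcDim < d := by
    refine Finset.vcDim_lt_of_not_shatters hd fun X hX hs => ?_
    -- Pullbacks do not separate points of one fibre, so a set they shatter meets each fibre at most
    -- once.
    have hinj : Set.InjOn π X := by
      intro i hi j hj hij
      obtain ⟨u, hu, hut⟩ := hs (Finset.singleton_subset_iff.2 hi)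
      obtain ⟨A, -, rfl⟩ := Finset.mem_image.1 hu
      have h1 : i ∈ X ∩ pull A := hut ▸ Finset.mem_singleton_self i
      have h2 : j ∈ X ∩ pull A := by
        rw [Finset.mem_inter, mem_pull] at h1 ⊢
        exact ⟨hj, hij ▸ h1.2⟩
      rw [hut, Finset.mem_singleton] at h2
      exact h2.symm
    refine hF (X.image π) (by rw [Finset.card_image_of_injOn hinj, hX]) ?_
    intro t ht
    obtain ⟨u, hu, hut⟩ := hs (Finset.filter_subset (fun i => π i ∈ t) X)
    obtain ⟨A, hA, rfl⟩ := Finset.mem_image.1 hu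
    refine ⟨A, hA, ?_⟩
    have key : ∀ i ∈ X, (π i ∈ A ↔ π i ∈ t) := fun i hi => by
      have := congrArg (i ∈ ·) hut
      simpa only [Finset.mem_inter, Finset.mem_filter, hi, true_and, mem_pull, eq_iff_iff]
        using this
    ext a
    rw [Finset.mem_inter, Finset.mem_image]
    constructor
    · rintro ⟨⟨i, hi, rfl⟩, ha⟩
      exact (key i hi).1 ha
    · intro ha
      obtain ⟨i, hi, rfl⟩ := Finset.mem_image.1 (ht ha)
      exact ⟨⟨i, hi, rfl⟩, (key i hi).2 ha⟩
  obtain ⟨M, hM, hmax⟩ := Finite.exists_le_maximal (p := fun G : Finset (Finset (Fin n)) =>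
    G.vcDim < d) hF'd
  have hMd : M.vcDim < d := hmax.1
  have hsec : ∀ σ : α → Fin n, (∀ a, π (σ a) = a) → ∀ G ∈ M,
      ¬ Forbids d F (Finset.univ.filter fun a => σ a ∈ G) := by
    rintro σ hσ G hG ⟨X, hX, hs⟩
    have hinj : Function.Injective σ := fun a b h => by rw [← hσ a, h, hσ]
    have : M.Shatters (X.image σ) := by
      refine hs.image_section σ fun u hu => ?_
      rcases Finset.mem_insert.1 hu with rfl | hu
      · exact ⟨G, hG, fun a => by simp⟩
      · exact ⟨pull u, hM (Finset.mem_image_of_mem _ hu), fun a => by rw [mem_pull, hσ]⟩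
    have := this.card_le_vcDim
    rw [Finset.card_image_of_injective _ hinj, hX] at this
    omega
  have hcov : M ⊆ (Finset.univ.filter fun B => ¬ Forbids d F B).image pull := by
    intro G hG
    refine Finset.mem_image.2 ⟨Finset.univ.filter fun a => e a ∈ G, ?_, ?_⟩
    · exact Finset.mem_filter.2 ⟨Finset.mem_univ _, hsec e hπe G hG⟩
    -- If `G` contained the copy `i` of `v` but not `j`, the sections through `i` and `j` would read
    -- `G` as two non-forbidden sets differing exactly in `v`.
    have hfib : ∀ i j, π i = v → π j = v → i ∈ G → j ∈ G := by
      intro i j hi hj hiG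
      by_contra hjG
      have hs : ∀ i, π i = v → ∀ a, π (Function.update e v i a) = a := by
        intro i hi a
        by_cases h : a = v
        · subst h; simpa using hi
        · rw [Function.update_of_ne h, hπe]
      have h1 := hsec _ (hs i hi) G hG
      have h2 := hsec _ (hs j hj) G hG
      set B := (Finset.univ.filter fun a => Function.update e v j a ∈ G) with hB
      have hvB : v ∉ B := by simp [hB, hjG]
      have hins : (Finset.univ.filter fun a => Function.update e v i a ∈ G) = insert v B := by
        ext a
        by_cases h : a = v
        · subst h; simp [hiG]
        · simp [hB, h]
      rw [hins] at h1
      exact (hv B hvB).elim h2 h1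
    ext i
    rw [mem_pull, Finset.mem_filter]
    by_cases h : π i = v
    · have hev : π (e (π i)) = v := by rw [hπe, h]
      exact ⟨fun h' => hfib _ _ hev h h'.2, fun h' => ⟨Finset.mem_univ _, hfib _ _ h hev h'⟩⟩
    · simp [hπv i h]
  -- By `hv` some set is forbidden; removing a point from the `d`-set it helps to shatter leaves a
  -- `(d - 1)`-set shattered by `F` alone.
  have hMdim : M.vcDim = d - 1 := by
    obtain ⟨B, X, hX, hs⟩ : ∃ B, Forbids d F B := by
      rcases hv ∅ (by simp) with h | h
      exacts [⟨_, h⟩, ⟨_, h⟩]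
    obtain ⟨x, hx⟩ : X.Nonempty := Finset.card_pos.1 (hX ▸ hd)
    have : M.Shatters ((X.erase x).image e) :=
      (hs.erase_of_insert hx).image_section e fun u hu =>
        ⟨pull u, hM (Finset.mem_image_of_mem _ hu), fun a => by rw [mem_pull, hπe]⟩
    have := this.card_le_vcDim
    rw [Finset.card_image_of_injective _ e.injective, Finset.card_erase_of_mem hx, hX] at this
    omega
  have hsat : IsKSaturated (d - 1) M := by
    refine ⟨fun G hG => ?_, hMdim⟩
    by_contra! hle
    exact hG.2 (hmax.2 (show G.vcDim < d by omega) hG.1)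
  refine iInf_le_of_le ⟨M, hsat⟩ ?_
  exact_mod_cast (Finset.card_le_card hcov).trans Finset.card_image_le

end Duplication

/-! ### Saturated families from mixed antisymmetric colorings -/

section Colorings

variable {α : Type*}

/-- The family of the `d`-sets of color `1`. -/
def colorClass [Fintype α] (d : ℕ) (f : Finset α → ZMod 2) : Finset (Finset α) :=
  Finset.univ.filter fun A => A.card = d ∧ f A = 1

theorem mem_colorClass [Fintype α] {d : ℕ} {f : Finset α → ZMod 2} {A : Finset α} :
    A ∈ colorClass d f ↔ A.card = d ∧ f A = 1 := by simp [colorClass]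

variable [DecidableEq α]

/-- A two-coloring `f` of the `d`-sets is mixed if for all disjoint `S`, `Y` with `|Y| = d` and
`0 < |S| < d` both colors occur among the `d`-sets `S ∪ T` with `T ⊆ Y`. -/
def Mixed (d : ℕ) (f : Finset α → ZMod 2) : Prop :=
  ∀ S Y : Finset α, Disjoint S Y → Y.card = d → 0 < S.card → S.card < d →
    ∀ c, ∃ T ⊆ Y, S.card + T.card = d ∧ f (S ∪ T) = c

theorem ZMod.eq_or_eq_add_one_of_two (a c : ZMod 2) : a = c ∨ a = c + 1 := by
  revert a c; decide

variable [Fintype α]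

theorem card_colorClass {d : ℕ} {f : Finset α → ZMod 2} (hα : Fintype.card α = 2 * d)
    (hanti : ∀ A : Finset α, A.card = d → f Aᶜ = f A + 1) :
    (colorClass d f).card = (2 * d).choose d / 2 := by
  have hcompl : ∀ A : Finset α, A.card = d → Aᶜ.card = d := fun A hA => by
    rw [Finset.card_compl, hA, hα]; omega
  have h1 : (colorClass d f).card =
      (Finset.univ.filter fun A : Finset α => A.card = d ∧ ¬ f A = 1).card := by
    refine Finset.card_nbij' compl compl ?_ ?_ (fun _ _ => compl_compl _) (fun _ _ => compl_compl _)
    · intro A hA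
      have := mem_colorClass.1 (Finset.mem_coe.1 hA)
      simp only [Finset.coe_filter, Finset.mem_univ, true_and, Set.mem_ofPred_eq]
      refine ⟨hcompl A this.1, ?_⟩
      rw [hanti A this.1, this.2]; decide
    · intro A hA
      simp only [Finset.coe_filter, Finset.mem_univ, true_and, Set.mem_ofPred_eq] at hA
      refine Finset.mem_coe.2 (mem_colorClass.2 ⟨hcompl A hA.1, ?_⟩)
      rw [hanti A hA.1]
      rcases ZMod.eq_or_eq_add_one_of_two (f A) 1 with h | h
      · exact absurd h hA.2
      · rw [h]; decide
  have h2 : (Finset.powersetCard d (Finset.univ : Finset α)).card = (2 * d).choose d := by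
    rw [Finset.card_powersetCard, Finset.card_univ, hα]
  have h3 : Finset.powersetCard d (Finset.univ : Finset α) =
      Finset.univ.filter fun A : Finset α => A.card = d := by
    ext A; simp [Finset.mem_powersetCard]
  have h4 := Finset.card_filter_add_card_filter_not
    (s := Finset.univ.filter fun A : Finset α => A.card = d) (fun A => f A = 1)
  rw [Finset.filter_filter, Finset.filter_filter, ← h3, h2] at h4
  rw [colorClass] at h1 ⊢
  omega

/-- Mixedness supplies every trace on a `d`-set `X` except `∅` and `X`, and antisymmetry supplies
exactly one of these two. For each `B` outside the color class, `X` can be chosen so that `B`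
supplies the other. Hence the non-forbidden sets lie in the color class; they all have `d` elements,
so any point can be duplicated. -/
theorem satVC_le_of_mixed {d n : ℕ} (hd : 2 ≤ d) (hα : Fintype.card α = 2 * d) (hn : 2 * d ≤ n)
    {f : Finset α → ZMod 2} (hanti : ∀ A : Finset α, A.card = d → f Aᶜ = f A + 1)
    (hf : Mixed d f) : satVC n (d - 1) ≤ (((2 * d).choose d / 2 : ℕ) : ℕ∞) := by
  classical
  have hcompl : ∀ A : Finset α, A.card = d → Aᶜ.card = d := fun A hA => by
    rw [Finset.card_compl, hA, hα]; omega
  have hcolor : ∀ A : Finset α, A.card = d → (A ∈ colorClass d f ↔ Aᶜ ∉ colorClass d f) := by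
    intro A hA
    simp only [mem_colorClass, hA, hcompl A hA, true_and, hanti A hA]
    generalize f A = a
    revert a; decide
  have hpattern : ∀ X : Finset α, X.card = d → ∀ S ⊆ X, S ≠ ∅ → S ≠ X →
      ∃ A ∈ colorClass d f, X ∩ A = S := by
    intro X hX S hS hS0 hSX
    obtain ⟨T, hT, hTc, hfT⟩ := hf S Xᶜ (Finset.disjoint_left.2 fun a ha ha' =>
      Finset.mem_compl.1 ha' (hS ha)) (hcompl X hX) (Finset.card_pos.2
        (Finset.nonempty_iff_ne_empty.2 hS0)) (hX ▸ Finset.card_lt_card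
          (Finset.ssubset_iff_subset_ne.2 ⟨hS, hSX⟩)) 1
    have hTX : Disjoint X T := Finset.disjoint_left.2 fun a ha ha' =>
      Finset.mem_compl.1 (hT ha') ha
    refine ⟨S ∪ T, mem_colorClass.2 ⟨?_, hfT⟩, ?_⟩
    · rw [Finset.card_union_of_disjoint (hTX.mono_left hS), hTc]
    · rw [Finset.inter_union_distrib_left, Finset.disjoint_iff_inter_eq_empty.1 hTX,
        Finset.union_empty, Finset.inter_eq_right.2 hS]
  have hshatter : ∀ X : Finset α, X.card = d → ∀ G : Finset (Finset α), colorClass d f ⊆ G →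
      (∃ A ∈ G, X ∩ A = ∅) → (∃ A ∈ G, X ∩ A = X) → G.Shatters X := by
    intro X hX G hG h0 h1 S hS
    by_cases hS0 : S = ∅
    · subst hS0; exact h0
    by_cases hSX : S = X
    · subst hSX; exact h1
    obtain ⟨A, hA, h⟩ := hpattern X hX S hS hS0 hSX
    exact ⟨A, hG hA, h⟩
  -- A set with more than `d` points contains `S ∪ Y` for some `S` of size one, and so has
  -- `d`-subsets of both colors.
  have hex : ∀ Z : Finset α, d < Z.card → ∀ c, ∃ A ⊆ Z, A.card = d ∧ f A = c := by
    intro Z hZ c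
    obtain ⟨x, hx⟩ : Z.Nonempty := Finset.card_pos.1 (by omega)
    obtain ⟨Y, hY, hYc⟩ := Finset.exists_subset_card_eq (s := Z.erase x) (n := d)
      (by rw [Finset.card_erase_of_mem hx]; omega)
    have hdis : Disjoint {x} Y := Finset.disjoint_singleton_left.2 fun h =>
      Finset.notMem_erase x Z (hY h)
    obtain ⟨T, hT, hTc, hfT⟩ := hf {x} Y hdis hYc (by simp) (by simp; omega) c
    refine ⟨{x} ∪ T, Finset.union_subset (by simpa using hx)
      ((hT.trans hY).trans (Finset.erase_subset _ _)), ?_, hfT⟩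
    rw [Finset.card_union_of_disjoint (hdis.mono_right hT), hTc]
  have hforb : ∀ B, B ∉ colorClass d f → Forbids d (colorClass d f) B := by
    intro B hB
    rcases lt_trichotomy B.card d with h | h | h
    · obtain ⟨X, hXB, hX, hfX⟩ := hex Bᶜ (by rw [Finset.card_compl, hα]; omega) 1
      refine ⟨X, hX, hshatter X hX _ (Finset.subset_insert _ _)
        ⟨B, Finset.mem_insert_self _ _, ?_⟩
        ⟨X, Finset.mem_insert_of_mem (mem_colorClass.2 ⟨hX, hfX⟩), Finset.inter_self _⟩⟩
      exact Finset.disjoint_iff_inter_eq_empty.1 (Finset.disjoint_left.2 fun a ha =>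
        Finset.mem_compl.1 (hXB ha))
    · refine ⟨B, h, hshatter B h _ (Finset.subset_insert _ _) ⟨Bᶜ, Finset.mem_insert_of_mem ?_,
        Finset.inter_compl _⟩ ⟨B, Finset.mem_insert_self _ _, Finset.inter_self _⟩⟩
      by_contra h'
      exact hB ((hcolor B h).2 h')
    · obtain ⟨X, hXB, hX, hfX⟩ := hex B h 0
      refine ⟨X, hX, hshatter X hX _ (Finset.subset_insert _ _)
        ⟨Xᶜ, Finset.mem_insert_of_mem ?_, Finset.inter_compl _⟩
        ⟨B, Finset.mem_insert_self _ _, Finset.inter_eq_left.2 hXB⟩⟩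
      refine mem_colorClass.2 ⟨hcompl X hX, ?_⟩
      rw [hanti X hX, hfX, zero_add]
  obtain ⟨v⟩ : Nonempty α := Fintype.card_pos_iff.1 (by omega)
  have hmain := satVC_le_card_not_forbids (n := n) (d := d) (by omega) (colorClass d f) v
    (by omega) ?_ ?_
  · refine hmain.trans ?_
    rw [← card_colorClass hα hanti]
    refine Nat.cast_le.2 (Finset.card_le_card fun B hB => ?_)
    by_contra h
    exact (Finset.mem_filter.1 hB).2 (hforb B h)
  · intro X hX hs
    obtain ⟨A, hA, hXA⟩ := hs (Finset.Subset.refl X)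
    obtain ⟨A', hA', hXA'⟩ := hs (Finset.empty_subset X)
    have hAX : X = A := Finset.eq_of_subset_of_card_le (Finset.inter_eq_left.1 hXA)
      (by rw [(mem_colorClass.1 hA).1, hX])
    have hAX' : A' = Xᶜ := by
      refine Finset.eq_of_subset_of_card_le (fun a ha => Finset.mem_compl.2 fun ha' => ?_)
        (by rw [(mem_colorClass.1 hA').1, hcompl X hX])
      exact Finset.notMem_empty a (hXA' ▸ Finset.mem_inter.2 ⟨ha', ha⟩)
    subst hAX hAX'
    exact (hcolor X hX).1 hA hA'
  · intro B hvB
    by_cases h : B ∈ colorClass d f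
    · refine Or.inr (hforb _ fun h' => ?_)
      have := (mem_colorClass.1 h').1
      rw [Finset.card_insert_of_notMem hvB, (mem_colorClass.1 h).1] at this
      omega
    · exact Or.inl (hforb B h)

end Colorings

/-! ### Odd `d`: parity corrected on transversals -/

section Transversals

variable {α : Type*} [DecidableEq α]

/-- With only two colors, a color missing from the slice of `d`-sets between `S` and `S ∪ Y` makes
the slice monochromatic. -/
theorem mixed_of_not_const {d : ℕ} {f : Finset α → ZMod 2}
    (h : ∀ S Y : Finset α, Disjoint S Y → Y.card = d → 0 < S.card → S.card < d → ∀ c,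
      (∀ A, S ⊆ A → A ⊆ S ∪ Y → A.card = d → f A = c) → False) : Mixed d f := by
  intro S Y hSY hY hS0 hSd c
  by_contra! hc
  refine h S Y hSY hY hS0 hSd (c + 1) fun A hSA hA hAd => ?_
  have hA' : S ∪ A \ S = A := Finset.union_sdiff_of_subset hSA
  have := hc (A \ S) (fun x hx => by
    have hx' := Finset.mem_sdiff.1 hx
    exact (Finset.mem_union.1 (hA hx'.1)).resolve_left hx'.2)
    (by rw [Finset.card_sdiff_of_subset hSA]; have := Finset.card_le_card hSA; omega)
  rw [hA'] at this
  exact (ZMod.eq_or_eq_add_one_of_two (f A) c).resolve_left this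

theorem Mixed.exists_between {d : ℕ} {f : Finset α → ZMod 2} (h : Mixed d f) {S Y : Finset α}
    (hSY : Disjoint S Y) (hY : Y.card = d) (hS0 : 0 < S.card) (hSd : S.card < d) (c : ZMod 2) :
    ∃ A, S ⊆ A ∧ A ⊆ S ∪ Y ∧ A.card = d ∧ f A = c := by
  obtain ⟨T, hT, hTc, hfT⟩ := h S Y hSY hY hS0 hSd c
  refine ⟨S ∪ T, Finset.subset_union_left, Finset.union_subset_union_right hT, ?_, hfT⟩
  rw [Finset.card_union_of_disjoint (hSY.mono_right hT), hTc]

/-- Exchange `p` for `q` in `A`. -/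
def Finset.swap (A : Finset α) (p q : α) : Finset α := insert q (A.erase p)

theorem Finset.mem_swap {A : Finset α} {p q x : α} :
    x ∈ A.swap p q ↔ x = q ∨ x ≠ p ∧ x ∈ A := by
  simp [Finset.swap]

theorem Finset.card_swap {A : Finset α} {p q : α} (hp : p ∈ A) (hq : q ∉ A) :
    (A.swap p q).card = A.card := by
  rw [Finset.swap, Finset.card_insert_of_notMem (fun h => hq (Finset.mem_of_mem_erase h)),
    Finset.card_erase_of_mem hp]
  have := Finset.card_pos.2 ⟨p, hp⟩
  omega

theorem Finset.card_swap_inter {A : Finset α} {p q : α} (hp : p ∈ A) (hq : q ∉ A)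
    (W : Finset α) : (A.swap p q ∩ W).card + (if p ∈ W then 1 else 0) =
      (A ∩ W).card + (if q ∈ W then 1 else 0) := by
  have h1 : (A.swap p q ∩ W).card = (A.erase p ∩ W).card + if q ∈ W then 1 else 0 := by
    rw [Finset.swap]
    split_ifs with h
    · rw [Finset.insert_inter_of_mem h, Finset.card_insert_of_notMem]
      exact fun h' => hq (Finset.mem_of_mem_erase (Finset.mem_inter.1 h').1)
    · rw [Finset.insert_inter_of_notMem h, add_zero]
  have h2 : (A ∩ W).card = (A.erase p ∩ W).card + if p ∈ W then 1 else 0 := by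
    conv_lhs => rw [← Finset.insert_erase hp]
    split_ifs with h
    · rw [Finset.insert_inter_of_mem h, Finset.card_insert_of_notMem]
      exact fun h' => Finset.notMem_erase p A (Finset.mem_inter.1 h').1
    · rw [Finset.insert_inter_of_notMem h, add_zero]
  omega

theorem Finset.subset_swap {S Y A : Finset α} (hSY : Disjoint S Y) {p q : α} (hp : p ∈ Y)
    (hS : S ⊆ A) : S ⊆ A.swap p q := fun _ hx =>
  Finset.mem_swap.2 (Or.inr ⟨fun h => Finset.disjoint_left.1 hSY hx (h ▸ hp), hS hx⟩)

theorem Finset.swap_subset {S Y A : Finset α} {p q : α} (hq : q ∈ Y)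
    (hA : A ⊆ S ∪ Y) : A.swap p q ⊆ S ∪ Y := fun x hx => by
  rcases Finset.mem_swap.1 hx with rfl | h
  · exact Finset.mem_union_right _ hq
  · exact hA h.2

theorem transversal_swap {σ : α → α} (hσ : σ.Involutive) {A : Finset α}
    (hA : ∀ x, σ x ∈ A ↔ x ∉ A) (p : α)
    (hp : p ∈ A) (x : α) : σ x ∈ A.swap p (σ p) ↔ x ∉ A.swap p (σ p) := by
  have h1 : σ p ≠ p := fun h => ((hA p).1 (h.symm ▸ hp)) hp
  simp only [Finset.mem_swap, hA, hσ.injective.eq_iff]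
  have h2 : σ x = p ↔ x = σ p := ⟨fun h => by rw [← h, hσ], fun h => by rw [h, hσ]⟩
  rw [ne_eq, h2]
  by_cases h3 : x = p
  · subst h3; simp [h1.symm]
  · by_cases h4 : x = σ p
    · subst h4; simp [h1]
    · simp [h3, h4]

variable [Fintype α]

/-- `A` contains exactly one point from every pair `{x, σ x}`, and is neither `W` nor its
complement. -/
def NontrivialTransversal (σ : α → α) (W A : Finset α) : Prop :=
  (∀ x, σ x ∈ A ↔ x ∉ A) ∧ A ≠ W ∧ A ≠ Wᶜ

open Classical in
/-- The parity of `A ∩ W`, changed on the nontrivial transversals. -/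
noncomputable def transversalColoring (σ : α → α) (W A : Finset α) : ZMod 2 :=
  ((A ∩ W).card : ZMod 2) + if NontrivialTransversal σ W A then 1 else 0

theorem NontrivialTransversal.compl {σ : α → α} {W A : Finset α}
    (h : NontrivialTransversal σ W A) : NontrivialTransversal σ W Aᶜ :=
  ⟨fun x => by rw [Finset.mem_compl, Finset.mem_compl, h.1], fun h' => h.2.2 (by
    rw [← h', compl_compl]), fun h' => h.2.1 (compl_injective h')⟩

/-- The parity changes because `|W|` is odd, while the correction is invariant under
complementation. -/
theorem transversalColoring_compl {σ : α → α} {W A : Finset α} (hW : Odd W.card) :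
    transversalColoring σ W Aᶜ = transversalColoring σ W A + 1 := by
  have h1 : NontrivialTransversal σ W Aᶜ ↔ NontrivialTransversal σ W A :=
    ⟨fun h => by simpa using h.compl, fun h => h.compl⟩
  have h2 : (Aᶜ ∩ W).card + (A ∩ W).card = W.card := by
    rw [add_comm, Finset.inter_comm A, Finset.inter_comm Aᶜ, ← Finset.sdiff_eq_inter_compl,
      Finset.card_inter_add_card_sdiff]
  have h3 : ((Aᶜ ∩ W).card : ZMod 2) + ((A ∩ W).card : ZMod 2) = 1 := by
    rw [← Nat.cast_add, h2]; exact (ZMod.natCast_eq_one_iff_odd).2 hW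
  unfold transversalColoring
  rw [eq_sub_of_add_eq h3]
  generalize ((A ∩ W).card : ZMod 2) = b
  by_cases h : NontrivialTransversal σ W A
  · rw [if_pos h, if_pos (h1.2 h)]
    revert b; decide
  · rw [if_neg h, if_neg (h1.not.2 h)]
    revert b; decide

section Slice

variable {d : ℕ} {σ : α → α} {W S Y : Finset α}

theorem NontrivialTransversal.eq_of_subset {σ : α → α} {W A : Finset α}
    (hWσ : ∀ x, σ x ∈ W ↔ x ∉ W) (h : NontrivialTransversal σ W A) : ¬ A ⊆ W := fun hA => by
  refine h.2.1 (hA.antisymm fun x hx => ?_)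
  by_contra hxA
  exact (hWσ x).1 (hA ((h.1 x).2 hxA)) hx

/-- By cardinality `Y = Wᶜ`, so `S ⊆ W`, and `S` together with the partners of `W \ S` is a
nontrivial transversal in the slice. For `w ∈ W \ S` and `s ∈ S` it contains `σ w` and omits `σ s`,
two points of `Y` on the same side, against `hA`. -/
theorem false_of_disjoint_side (hσ : σ.Involutive) (hWσ : ∀ x, σ x ∈ W ↔ x ∉ W)
    (hWd : Wᶜ.card = d) (hSY : Disjoint S Y)
    (hY : Y.card = d) (hS0 : 0 < S.card) (hSd : S.card < d)
    (hA : ∀ A, S ⊆ A → A ⊆ S ∪ Y → A.card = d → NontrivialTransversal σ W A →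
      ∀ p ∈ Y, p ∈ A → ∀ q ∈ Y, q ∉ A → ¬ (p ∈ W ↔ q ∈ W))
    (h : ∀ y ∈ Y, y ∉ W) : False := by
  have hYW : Y = Wᶜ := Finset.eq_of_subset_of_card_le (fun y hy => Finset.mem_compl.2 (h y hy))
    (by omega)
  have hSW : S ⊆ W := fun x hx => by
    by_contra hxW
    exact Finset.disjoint_left.1 hSY hx (hYW ▸ Finset.mem_compl.2 hxW)
  have himage : (W \ S).image σ ⊆ Y := by
    intro x hx
    obtain ⟨y, hy, rfl⟩ := Finset.mem_image.1 hx
    rw [hYW, Finset.mem_compl, hWσ, not_not]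
    exact (Finset.mem_sdiff.1 hy).1
  have hWd' : W.card = d := by
    have : W.card = Wᶜ.card := by
      refine Finset.card_bij' (fun x _ => σ x) (fun x _ => σ x) ?_ ?_ (fun x _ => hσ x)
        (fun x _ => hσ x)
      · intro x hx; rw [Finset.mem_compl, hWσ, not_not]; exact hx
      · intro x hx; rw [hWσ]; exact Finset.mem_compl.1 hx
    omega
  have hcard : ((W \ S).image σ).card = d - S.card := by
    rw [Finset.card_image_of_injective _ hσ.injective, Finset.card_sdiff_of_subset hSW, hWd']
  set A := S ∪ (W \ S).image σ with hAdef
  have hmem : ∀ x, x ∈ A ↔ x ∈ S ∨ σ x ∈ W ∧ σ x ∉ S := by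
    intro x
    rw [hAdef, Finset.mem_union, Finset.mem_image]
    refine or_congr_right ⟨?_, fun hx => ⟨σ x, Finset.mem_sdiff.2 hx, hσ x⟩⟩
    rintro ⟨y, hy, rfl⟩
    rw [hσ]; exact Finset.mem_sdiff.1 hy
  obtain ⟨s, hs⟩ := Finset.card_pos.1 hS0
  obtain ⟨w, hw, hwS⟩ : ∃ w ∈ W, w ∉ S := by
    by_contra! hc
    have := Finset.card_le_card (show W ⊆ S from hc)
    omega
  have hAc : A.card = d := by
    rw [hAdef, Finset.card_union_of_disjoint (hSY.mono_right himage), hcard]; omega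
  have hR : NontrivialTransversal σ W A := by
    refine ⟨fun x => ?_, fun h' => ?_, fun h' => ?_⟩
    · rw [hmem, hmem, hσ, hWσ]
      have h1 : x ∈ S → x ∈ W := fun h => hSW h
      have h2 : σ x ∈ S → x ∉ W := fun h => (hWσ x).1 (hSW h)
      tauto
    · have : w ∈ A := h' ▸ hw
      rw [hmem, hWσ] at this
      tauto
    · have : s ∈ A := (hmem s).2 (Or.inl hs)
      rw [h', Finset.mem_compl] at this
      exact this (hSW hs)
  have hσs : σ s ∈ Y := by rw [hYW, Finset.mem_compl, hWσ, not_not]; exact hSW hs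
  have hσw : σ w ∈ Y := by rw [hYW, Finset.mem_compl, hWσ, not_not]; exact hw
  refine hA A Finset.subset_union_left (Finset.union_subset_union_right himage) hAc hR (σ w) hσw
    ((hmem _).2 (Or.inr ?_)) (σ s) hσs ?_ ?_
  · rw [hσ]; exact ⟨hw, hwS⟩
  · rw [hR.1, not_not, hmem]; exact Or.inl hs
  · simp [h _ hσs, h _ hσw]

/-- By `hB` an exchange across `W` toggles being a nontrivial transversal. If `Y` has two points on
each side, two such exchanges restore this property and force `|Y| = 4`. If one side has a single
point of `Y`, exchanging a point with its partner, which keeps transversals, contradicts the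
toggling, unless `A ⊆ W` or `|Y| ≤ 2`. -/
theorem false_of_side_eq (hd : 3 ≤ d) (hodd : Odd d) (hσ : σ.Involutive)
    (hWσ : ∀ x, σ x ∈ W ↔ x ∉ W)
    (hWd : Wᶜ.card = d) (hSY : Disjoint S Y) (hY : Y.card = d)
    (hA : ∀ A, S ⊆ A → A ⊆ S ∪ Y → A.card = d → NontrivialTransversal σ W A →
      ∀ p ∈ Y, p ∈ A → ∀ q ∈ Y, q ∉ A → ¬ (p ∈ W ↔ q ∈ W))
    (hB : ∀ A, S ⊆ A → A ⊆ S ∪ Y → A.card = d →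
      ∀ p ∈ Y, p ∈ A → ∀ q ∈ Y, q ∉ A → (p ∈ W ↔ q ∉ W) →
        (NontrivialTransversal σ W (A.swap p q) ↔ ¬ NontrivialTransversal σ W A))
    {A : Finset α} (hSA : S ⊆ A) (hAS : A ⊆ S ∪ Y) (hAd : A.card = d)
    (hR : NontrivialTransversal σ W A) (hAY : ∀ y ∈ Y, y ∈ A ↔ y ∈ W)
    {p q : α} (hp : p ∈ Y) (hpW : p ∈ W) (hq : q ∈ Y) (hqW : q ∉ W) : False := by
  have hpA : p ∈ A := (hAY p hp).2 hpW
  have hqA : q ∉ A := fun h => hqW ((hAY q hq).1 h)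
  by_cases hp' : ∃ p' ∈ Y, p' ∈ W ∧ p' ≠ p
  · by_cases hq' : ∃ q' ∈ Y, q' ∉ W ∧ q' ≠ q
    · obtain ⟨p', hp', hpW', hpp⟩ := hp'
      obtain ⟨q', hq', hqW', hqq⟩ := hq'
      have hpA' : p' ∈ A := (hAY p' hp').2 hpW'
      have hqA' : q' ∉ A := fun h => hqW' ((hAY q' hq').1 h)
      have hpq : p' ≠ q := fun h => hqA (h ▸ hpA')
      have hpq' : p ≠ q' := fun h => hqA' (h ▸ hpA)
      have hpq1 : p' ≠ q' := fun h => hqA' (h ▸ hpA')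
      have hpq2 : p ≠ q := fun h => hqA (h ▸ hpA)
      have hcard1 := (Finset.card_swap hpA hqA).trans hAd
      have hsub1 := Finset.subset_swap (q := q) hSY hp hSA
      have hsub2 := Finset.swap_subset (p := p) hq hAS
      have hR1 : ¬ NontrivialTransversal σ W (A.swap p q) := fun h =>
        (hB A hSA hAS hAd p hp hpA q hq hqA (by tauto)).1 h hR
      have hpA1 : p' ∈ A.swap p q := Finset.mem_swap.2 (Or.inr ⟨hpp, hpA'⟩)
      have hqA1 : q' ∉ A.swap p q := fun h => by
        rcases Finset.mem_swap.1 h with h | h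
        · exact hqq h
        · exact hqA' h.2
      have hR2 := (hB _ hsub1 hsub2 hcard1 p' hp' hpA1 q' hq' hqA1 (by tauto)).2 hR1
      have hA2 := hA _ (Finset.subset_swap (q := q') hSY hp' hsub1)
        (Finset.swap_subset (p := p') hq' hsub2) ((Finset.card_swap hpA1 hqA1).trans hcard1) hR2
      have hYeq : Y = {p, p', q, q'} := by
        ext y
        simp only [Finset.mem_insert, Finset.mem_singleton]
        refine ⟨fun hy => ?_, ?_⟩
        · by_contra! hne
          by_cases hyW : y ∈ W
          · refine hA2 y hy ?_ p hp ?_ (by tauto)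
            · simp only [Finset.mem_swap]
              exact Or.inr ⟨hne.2.1, Or.inr ⟨hne.1, (hAY y hy).2 hyW⟩⟩
            · simp [Finset.mem_swap, hpq', hpq2]
          · refine hA2 q hq ?_ y hy ?_ (by tauto)
            · simp [Finset.mem_swap, hpq.symm]
            · have : y ∉ A := fun h => hyW ((hAY y hy).1 h)
              simp [Finset.mem_swap, hne, this]
        · rintro (rfl | rfl | rfl | rfl) <;> assumption
      have : Y.card = 4 := by
        rw [hYeq, Finset.card_insert_of_notMem, Finset.card_insert_of_notMem,
          Finset.card_pair hqq.symm]
        · simp [hpq, hpq1]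
        · simp [hpp.symm, hpq2, hpq']
      rw [hY] at this
      subst this
      exact absurd hodd (by decide)
    · push Not at hq'
      -- Now `q` is the only point of `Y` outside `W`, so `A` is `Y \ {q}` with one further point
      -- `s`. Since `A ⊆ W` is impossible, `s ∉ W`; hence the partner of `q` lies in `Y` and can be
      -- exchanged for `q`.
      obtain ⟨s, hs, hsY⟩ : ∃ s ∈ A, s ∉ Y := by
        by_contra! hc
        have : A = Y := Finset.eq_of_subset_of_card_le hc (by omega)
        exact hqA (this ▸ hq)
      have hAeq : A = insert s (Y.erase q) := by
        refine (Finset.eq_of_subset_of_card_le ?_ ?_).symm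
        · intro x hx
          rcases Finset.mem_insert.1 hx with rfl | hx
          · exact hs
          · refine (hAY x (Finset.mem_of_mem_erase hx)).2 ?_
            by_contra hxW
            exact Finset.ne_of_mem_erase hx (hq' x (Finset.mem_of_mem_erase hx) hxW)
        · rw [Finset.card_insert_of_notMem (fun h => hsY (Finset.mem_of_mem_erase h)),
            Finset.card_erase_of_mem hq]
          omega
      have hsW : s ∉ W := fun hsW => hR.eq_of_subset hWσ fun x hx => by
        rw [hAeq] at hx
        rcases Finset.mem_insert.1 hx with rfl | hx
        · exact hsW
        · by_contra hxW
          exact Finset.ne_of_mem_erase hx (hq' x (Finset.mem_of_mem_erase hx) hxW)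
      have hσqA : σ q ∈ A := (hR.1 q).2 hqA
      have hσqW : σ q ∈ W := (hWσ q).2 hqW
      have hσqY : σ q ∈ Y := by
        rw [hAeq] at hσqA
        rcases Finset.mem_insert.1 hσqA with h | h
        · exact absurd (h ▸ hσqW) hsW
        · exact Finset.mem_of_mem_erase h
      refine (hB A hSA hAS hAd (σ q) hσqY hσqA q hq hqA (by tauto)).1 ?_ hR
      refine ⟨?_, fun h => hqW (h ▸ Finset.mem_swap.2 (Or.inl rfl)), fun h => ?_⟩
      · have := transversal_swap hσ hR.1 (σ q) hσqA
        rwa [hσ] at this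
      · obtain ⟨r, hr, hrW, hrq⟩ : ∃ r ∈ Y, r ∈ W ∧ r ≠ σ q := by
          obtain ⟨p', hp', hpW', hpp⟩ := hp'
          by_cases h : p = σ q
          · exact ⟨p', hp', hpW', h ▸ hpp⟩
          · exact ⟨p, hp, hpW, h⟩
        have : r ∈ A.swap (σ q) q := Finset.mem_swap.2 (Or.inr ⟨hrq, (hAY r hr).2 hrW⟩)
        rw [h, Finset.mem_compl] at this
        exact this hrW
  · push Not at hp'
    have hσp : σ p ∉ W := by rw [hWσ, not_not]; exact hpW
    have hσpA : σ p ∉ A := by rw [hR.1, not_not]; exact hpA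
    -- Here `p` is the only point of `Y` in `W`. If its partner is in `Y`, exchanging them must give
    -- `Wᶜ`, whence `Y ⊆ {p, σ p}`; otherwise `Y` contains all of `Wᶜ` except `σ p`, and `A ⊆ W`.
    by_cases hσY : σ p ∈ Y
    · have h1 := (hB A hSA hAS hAd p hp hpA (σ p) hσY hσpA (by tauto)).not.2 (by tauto)
      have h2 : A.swap p (σ p) = Wᶜ := by
        by_contra h
        refine h1 ⟨transversal_swap hσ hR.1 p hpA, fun h' => ?_, h⟩
        exact hσp (h' ▸ Finset.mem_swap.2 (Or.inl rfl))
      have h3 : Y ⊆ {p, σ p} := by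
        intro y hy
        rw [Finset.mem_insert, Finset.mem_singleton]
        by_cases hyp : y = p
        · exact Or.inl hyp
        have hyW : y ∉ W := fun h => hyp (hp' y hy h)
        have : y ∈ A.swap p (σ p) := h2 ▸ Finset.mem_compl.2 hyW
        rcases Finset.mem_swap.1 this with h | h
        · exact Or.inr h
        · exact absurd ((hAY y hy).1 h.2) hyW
      have := Finset.card_le_card h3
      have := Finset.card_le_two (a := p) (b := σ p)
      omega
    · have h1 : Y.erase p = Wᶜ.erase (σ p) := by
        refine Finset.eq_of_subset_of_card_le (fun y hy => ?_) ?_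
        · have hy' := Finset.mem_erase.1 hy
          exact Finset.mem_erase.2 ⟨fun h => hσY (h ▸ hy'.2),
            Finset.mem_compl.2 fun h => hy'.1 (hp' y hy'.2 h)⟩
        · rw [Finset.card_erase_of_mem hp, Finset.card_erase_of_mem (Finset.mem_compl.2 hσp)]
          omega
      refine hR.eq_of_subset hWσ fun x hx => ?_
      by_contra hxW
      have : x ∈ Y.erase p := by
        rw [h1]
        exact Finset.mem_erase.2 ⟨fun h => hσpA (h ▸ hx), Finset.mem_compl.2 hxW⟩
      exact hxW ((hAY x (Finset.mem_of_mem_erase this)).1 hx)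

end Slice

theorem NontrivialTransversal.compl_side {σ : α → α} {W A : Finset α} :
    NontrivialTransversal σ Wᶜ A ↔ NontrivialTransversal σ W A := by
  rw [NontrivialTransversal, NontrivialTransversal, compl_compl]
  tauto

/-- In a monochromatic slice every parity change must be compensated by a change in transversality.
If `Y` meets both sides of `W`, this produces a nontrivial transversal in the slice, whose part in
`Y` is `Y ∩ W` or `Y \ W`; the two cases are exchanged by replacing `W` with `Wᶜ`. -/
theorem mixed_transversalColoring {d : ℕ} {σ : α → α} {W : Finset α} (hd : 3 ≤ d) (hodd : Odd d)
    (hσ : σ.Involutive) (hWσ : ∀ x, σ x ∈ W ↔ x ∉ W) (hW : W.card = d) (hWc : Wᶜ.card = d) :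
    Mixed d (transversalColoring σ W) := by
  refine mixed_of_not_const fun S Y hSY hY hS0 hSd c hc => ?_
  have key : ∀ A, S ⊆ A → A ⊆ S ∪ Y → A.card = d → ∀ p ∈ Y, p ∈ A → ∀ q ∈ Y, q ∉ A →
      ((p ∈ W ↔ q ∈ W) ↔
        (NontrivialTransversal σ W (A.swap p q) ↔ NontrivialTransversal σ W A)) := by
    intro A hSA hAS hAd p hp hpA q hq hqA
    have h1 := hc A hSA hAS hAd
    have h2 := hc _ (Finset.subset_swap (q := q) hSY hp hSA)
      (Finset.swap_subset (p := p) hq hAS) ((Finset.card_swap hpA hqA).trans hAd)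
    have h3 := congrArg (Nat.cast (R := ZMod 2)) (Finset.card_swap_inter hpA hqA W)
    push_cast at h3
    rw [← h2] at h1
    simp only [transversalColoring] at h1
    revert h1 h3
    generalize ((A ∩ W).card : ZMod 2) = a
    generalize ((A.swap p q ∩ W).card : ZMod 2) = b
    split_ifs <;> simp_all <;> (revert a b; decide)
  -- A same-side exchange cannot lead from one transversal to another, because the partner of `p`
  -- lies on the other side.
  have hA : ∀ A, S ⊆ A → A ⊆ S ∪ Y → A.card = d → NontrivialTransversal σ W A →
      ∀ p ∈ Y, p ∈ A → ∀ q ∈ Y, q ∉ A → ¬ (p ∈ W ↔ q ∈ W) := by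
    intro A hSA hAS hAd hR p hp hpA q hq hqA hpq
    have hR' := ((key A hSA hAS hAd p hp hpA q hq hqA).1 hpq).2 hR
    have h1 : σ p ∉ A := fun h => (hR.1 p).1 h hpA
    have hpq' : p ≠ q := fun h => hqA (h ▸ hpA)
    have h2 : σ p ∈ A.swap p q := (hR'.1 p).2 fun h => by
      rcases Finset.mem_swap.1 h with h | h
      · exact hpq' h
      · exact h.1 rfl
    rcases Finset.mem_swap.1 h2 with h | h
    · have := hWσ p
      rw [h] at this
      tauto
    · exact h1 h.2
  have hB : ∀ A, S ⊆ A → A ⊆ S ∪ Y → A.card = d →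
      ∀ p ∈ Y, p ∈ A → ∀ q ∈ Y, q ∉ A → (p ∈ W ↔ q ∉ W) →
        (NontrivialTransversal σ W (A.swap p q) ↔ ¬ NontrivialTransversal σ W A) := by
    intro A hSA hAS hAd p hp hpA q hq hqA hpq
    have := key A hSA hAS hAd p hp hpA q hq hqA
    tauto
  have hWσ' : ∀ x, σ x ∈ Wᶜ ↔ x ∉ Wᶜ := fun x => by
    rw [Finset.mem_compl, Finset.mem_compl, hWσ]
  have hA' : ∀ A, S ⊆ A → A ⊆ S ∪ Y → A.card = d → NontrivialTransversal σ Wᶜ A →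
      ∀ p ∈ Y, p ∈ A → ∀ q ∈ Y, q ∉ A → ¬ (p ∈ Wᶜ ↔ q ∈ Wᶜ) := by
    intro A hSA hAS hAd hR p hp hpA q hq hqA
    have := hA A hSA hAS hAd (NontrivialTransversal.compl_side.1 hR) p hp hpA q hq hqA
    rw [Finset.mem_compl, Finset.mem_compl]
    tauto
  have hB' : ∀ A, S ⊆ A → A ⊆ S ∪ Y → A.card = d →
      ∀ p ∈ Y, p ∈ A → ∀ q ∈ Y, q ∉ A → (p ∈ Wᶜ ↔ q ∉ Wᶜ) →
        (NontrivialTransversal σ Wᶜ (A.swap p q) ↔ ¬ NontrivialTransversal σ Wᶜ A) := by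
    intro A hSA hAS hAd p hp hpA q hq hqA hpq
    rw [Finset.mem_compl, Finset.mem_compl] at hpq
    rw [NontrivialTransversal.compl_side, NontrivialTransversal.compl_side]
    exact hB A hSA hAS hAd p hp hpA q hq hqA (by tauto)
  obtain ⟨p, hp, hpW⟩ : ∃ p ∈ Y, p ∈ W := by
    by_contra! h
    exact false_of_disjoint_side hσ hWσ hWc hSY hY hS0 hSd hA h
  obtain ⟨q, hq, hqW⟩ : ∃ q ∈ Y, q ∉ W := by
    by_contra! h
    exact false_of_disjoint_side hσ hWσ' (by rw [compl_compl, hW]) hSY hY hS0 hSd hA'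
      (fun y hy => by rw [Finset.mem_compl, not_not]; exact h y hy)
  have hpq : p ≠ q := fun h => hqW (h ▸ hpW)
  have hpY : p ∉ S := fun h => Finset.disjoint_left.1 hSY h hp
  have hqY : q ∉ S := fun h => Finset.disjoint_left.1 hSY h hq
  -- Either this `B` or its exchange of `p` for `q` is a nontrivial transversal.
  obtain ⟨B, hSB, hBS, hBd⟩ := Finset.exists_subsuperset_card_eq (s := insert p S)
    (t := (S ∪ Y).erase q) (n := d)
    (by
      intro x hx
      rcases Finset.mem_insert.1 hx with rfl | hx
      · exact Finset.mem_erase.2 ⟨hpq, Finset.mem_union_right _ hp⟩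
      · exact Finset.mem_erase.2 ⟨fun h => hqY (h ▸ hx), Finset.mem_union_left _ hx⟩)
    (by rw [Finset.card_insert_of_notMem hpY]; omega)
    (by
      rw [Finset.card_erase_of_mem (Finset.mem_union_right _ hq),
        Finset.card_union_of_disjoint hSY]
      omega)
  have hpB : p ∈ B := hSB (Finset.mem_insert_self _ _)
  have hqB : q ∉ B := fun h => Finset.notMem_erase q _ (hBS h)
  have hSB' : S ⊆ B := (Finset.subset_insert _ _).trans hSB
  have hBS' : B ⊆ S ∪ Y := hBS.trans (Finset.erase_subset _ _)
  have hmain : ∀ A, S ⊆ A → A ⊆ S ∪ Y → A.card = d → NontrivialTransversal σ W A → False := by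
    intro A hSA hAS hAd hR
    have h1 := hA A hSA hAS hAd hR
    by_cases hpA : p ∈ A
    · by_cases hqA : q ∈ A
      · have : S ∪ Y ⊆ A := Finset.union_subset hSA fun y hy => by
          by_contra hyA
          by_cases hyW : y ∈ W
          · exact h1 p hp hpA y hy hyA (by tauto)
          · exact h1 q hq hqA y hy hyA (by tauto)
        have := Finset.card_le_card this
        rw [Finset.card_union_of_disjoint hSY] at this
        omega
      · refine false_of_side_eq hd hodd hσ hWσ hWc hSY hY hA hB hSA hAS hAd hR ?_ hp hpW hq hqW
        intro y hy
        refine ⟨fun hyA => ?_, fun hyW => ?_⟩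
        · by_contra hyW
          exact h1 y hy hyA q hq hqA (by tauto)
        · by_contra hyA
          exact h1 p hp hpA y hy hyA (by tauto)
    · by_cases hqA : q ∈ A
      · refine false_of_side_eq (W := Wᶜ) hd hodd hσ hWσ' (by rw [compl_compl, hW]) hSY hY hA' hB'
          hSA hAS hAd (NontrivialTransversal.compl_side.2 hR) ?_ hq (Finset.mem_compl.2 hqW) hp
          (by rw [Finset.mem_compl, not_not]; exact hpW)
        intro y hy
        rw [Finset.mem_compl]
        refine ⟨fun hyA hyW => h1 y hy hyA p hp hpA (by tauto), fun hyW => ?_⟩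
        by_contra hyA
        exact h1 q hq hqA y hy hyA (by tauto)
      · have : A ⊆ S := fun y hyA => by
          by_contra hyS
          have hy := (Finset.mem_union.1 (hAS hyA)).resolve_left hyS
          by_cases hyW : y ∈ W
          · exact h1 y hy hyA p hp hpA (by tauto)
          · exact h1 y hy hyA q hq hqA (by tauto)
        have := Finset.card_le_card this
        omega
  by_cases hR : NontrivialTransversal σ W B
  · exact hmain B hSB' hBS' hBd hR
  · exact hmain _ (Finset.subset_swap hSY hp hSB') (Finset.swap_subset hq hBS')
      ((Finset.card_swap hpB hqB).trans hBd)
      ((hB B hSB' hBS' hBd p hp hpB q hq hqB (by tauto)).2 hR)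

/-- For odd `d` there is an antisymmetric mixed coloring of the `d`-subsets of a `2d`-set. -/
theorem exists_mixed_of_odd {d : ℕ} (hd : 3 ≤ d) (hodd : Odd d) :
    ∃ f : Finset (Fin d × Bool) → ZMod 2, (∀ A, f Aᶜ = f A + 1) ∧ Mixed d f := by
  set W : Finset (Fin d × Bool) := Finset.univ ×ˢ {true}
  have hW : W.card = d := by simp [W]
  have hWc : Wᶜ.card = d := by
    rw [Finset.card_compl, hW, Fintype.card_prod, Fintype.card_fin, Fintype.card_bool]; omega
  refine ⟨transversalColoring (fun x => (x.1, !x.2)) W, fun A =>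
    transversalColoring_compl (hW.symm ▸ hodd), mixed_transversalColoring hd hodd (fun x => by simp)
    (fun x => ?_) hW hWc⟩
  obtain ⟨i, b⟩ := x
  cases b <;> simp [W]

end Transversals

/-! ### Explicit colorings checked as bit tables -/

section BitTables

open Finset

/-- The index of a finite set of natural numbers in a table of bits. -/
def bitCode (A : Finset ℕ) : ℕ := ∑ i ∈ A, 2 ^ i

theorem bitCode_empty : bitCode ∅ = 0 := rfl

theorem bitCode_insert {A : Finset ℕ} {i : ℕ} (h : i ∉ A) :
    bitCode (insert i A) = 2 ^ i + bitCode A := Finset.sum_insert h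

theorem bitCode_eq_add_erase {A : Finset ℕ} {i : ℕ} (h : i ∈ A) :
    bitCode A = 2 ^ i + bitCode (A.erase i) := (Finset.add_sum_erase _ _ h).symm

theorem bitCode_injective : Function.Injective bitCode := Finset.geomSum_injective le_rfl

theorem Finset.erase_subset_range {A : Finset ℕ} {i : ℕ} (h : A ⊆ range (i + 1)) :
    A.erase i ⊆ range i := fun x hx => by
  have := mem_range.1 (h (mem_of_mem_erase hx))
  have := ne_of_mem_erase hx
  exact mem_range.2 (by omega)

theorem Finset.subset_range_of_notMem {A : Finset ℕ} {i : ℕ} (h : A ⊆ range (i + 1))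
    (hi : i ∉ A) : A ⊆ range i := by
  rw [← erase_eq_of_notMem hi]; exact erase_subset_range h

/-- Checks that for every `X ⊆ {0, …, i - 1}` whose complement has `y` elements, all subsets of `X`
except `∅` and `X` are traces on `X` of sets in the table `t`. In the course of the recursion `x` is
the part of `X` found so far and `e` the table of its subsets. -/
def slicesMet : ℕ → ℕ → ℕ → ℕ → ℕ → Bool
  | 0, y, x, e, t => y != 0 || (t ||| 1 ||| 1 <<< x) &&& e == e
  | i + 1, y, x, e, t =>
    (y == 0 || slicesMet i (y - 1) x e (t ||| t >>> 2 ^ i)) &&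
      (Nat.ble (i + 1) y || slicesMet i y (x + 2 ^ i) (e ||| e <<< 2 ^ i) t)

/-- The number `q` codes the part of the pattern already decided. Or-ing `t` with its shift by `2 ^
i` leaves open whether `i ∈ Y` belongs to `T`; doubling `e` admits both choices for `i ∈ X`. At the
leaf, bits `0` and `x` exempt the patterns `∅` and `X`. -/
theorem exists_testBit_of_slicesMet {i y x e t q : ℕ} (h : slicesMet i y x e t = true)
    {S Y : Finset ℕ} (hS : S ⊆ range i) (hY : Y ⊆ range i) (hSY : Disjoint S Y) (hy : Y.card = y)
    (he : e.testBit q = true) (h0 : q + bitCode S ≠ 0)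
    (h1 : q + bitCode S ≠ x + bitCode (range i \ Y)) :
    ∃ T ⊆ Y, t.testBit (q + bitCode S + bitCode T) = true := by
  induction i generalizing y x e t q S Y with
  | zero =>
    have hS : S = ∅ := by simpa using hS
    have hY : Y = ∅ := by simpa using hY
    subst hS hY
    simp only [card_empty] at hy
    subst hy
    refine ⟨∅, Subset.refl _, ?_⟩
    simp only [slicesMet, bne_self_eq_false, Bool.false_or, beq_iff_eq] at h
    simp only [bitCode_empty, add_zero, range_zero, sdiff_self, bot_eq_empty] at h0 h1 ⊢
    rw [← h] at he
    simp only [Nat.testBit_and, Nat.testBit_or, Bool.and_eq_true, Bool.or_eq_true] at he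
    rcases he.1 with (h' | h') | h'
    · exact h'
    · exact absurd (Nat.testBit_one_eq_true_iff_self_eq_zero.1 h') h0
    · rw [Nat.one_shiftLeft, Nat.testBit_two_pow] at h'
      exact absurd (of_decide_eq_true h').symm h1
  | succ i ih =>
    simp only [slicesMet, Bool.and_eq_true, Bool.or_eq_true, beq_iff_eq] at h
    by_cases hiY : i ∈ Y
    · have hiS : i ∉ S := fun hi => disjoint_left.1 hSY hi hiY
      have hy0 : y ≠ 0 := hy ▸ (card_pos.2 ⟨i, hiY⟩).ne'
      have hrange : range (i + 1) \ Y = range i \ Y.erase i := by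
        ext z
        simp only [mem_sdiff, mem_range, mem_erase]
        by_cases hz : z = i
        · subst hz; simp [hiY]
        · have : z < i + 1 ↔ z < i := by omega
          simp [hz, this]
      obtain ⟨T, hT, hbit⟩ := ih (h.1.resolve_left hy0) (subset_range_of_notMem hS hiS)
        (erase_subset_range hY) (hSY.mono_right (erase_subset _ _))
        (by rw [card_erase_of_mem hiY, hy]) he h0 (hrange ▸ h1)
      rw [Nat.testBit_or, Bool.or_eq_true, Nat.testBit_shiftRight] at hbit
      rcases hbit with hbit | hbit
      · exact ⟨T, hT.trans (erase_subset _ _), hbit⟩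
      · refine ⟨insert i T, insert_subset hiY (hT.trans (erase_subset _ _)), ?_⟩
        rw [bitCode_insert fun hi => notMem_erase i Y (hT hi), ← hbit]
        congr 1
        ring
    · have hY' := subset_range_of_notMem hY hiY
      have hyi : ¬ Nat.ble (i + 1) y = true := fun hle => by
        have := Nat.le_of_ble_eq_true hle
        have := card_le_card hY'
        rw [card_range] at this
        omega
      have hrange : bitCode (range (i + 1) \ Y) = 2 ^ i + bitCode (range i \ Y) := by
        rw [range_add_one, insert_sdiff_of_notMem _ hiY, bitCode_insert (by simp)]
      rw [hrange] at h1
      have h2 := h.2.resolve_left hyi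
      by_cases hiS : i ∈ S
      · rw [bitCode_eq_add_erase hiS] at h0 h1 ⊢
        obtain ⟨T, hT, hbit⟩ := ih (q := q + 2 ^ i) h2 (erase_subset_range hS) hY'
          (hSY.mono_left (erase_subset _ _)) hy
          (by simp [Nat.testBit_or, Nat.testBit_shiftLeft, he]) (by omega) (by omega)
        exact ⟨T, hT, by rw [← hbit]; congr 1; ring⟩
      · exact ih h2 (subset_range_of_notMem hS hiS) hY' hSY hy
          (by simp [Nat.testBit_or, he]) h0 (by omega)

/-- The tables `a` and `b` partition the sets with `d` elements (of which `c` have been chosen). -/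
def tablesPartition (d : ℕ) : ℕ → ℕ → ℕ → ℕ → Bool
  | 0, c, a, b => if c = d then a.testBit 0 != b.testBit 0 else !a.testBit 0 && !b.testBit 0
  | i + 1, c, a, b =>
    tablesPartition d i c a b && tablesPartition d i (c + 1) (a >>> 2 ^ i) (b >>> 2 ^ i)

theorem tablesPartition_spec {d i c a b : ℕ} (h : tablesPartition d i c a b = true) {A : Finset ℕ}
    (hA : A ⊆ range i) :
    (c + A.card = d → a.testBit (bitCode A) = !b.testBit (bitCode A)) ∧ (c + A.card ≠ d →
      a.testBit (bitCode A) = false ∧ b.testBit (bitCode A) = false) := by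
  induction i generalizing c a b A with
  | zero =>
    have hA : A = ∅ := by simpa using hA
    subst hA
    rw [tablesPartition] at h
    rw [card_empty, add_zero, bitCode_empty]
    split_ifs at h with hc
    · refine ⟨fun _ => ?_, fun h' => absurd hc h'⟩
      revert h
      generalize a.testBit 0 = u
      generalize b.testBit 0 = v
      revert u v; decide
    · exact ⟨fun h' => absurd h' hc, fun _ => by simpa using h⟩
  | succ i ih =>
    rw [tablesPartition, Bool.and_eq_true] at h
    by_cases hi : i ∈ A
    · have := ih h.2 (erase_subset_range hA)
      rw [Nat.testBit_shiftRight, Nat.testBit_shiftRight, ← bitCode_eq_add_erase hi,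
        card_erase_of_mem hi] at this
      have := card_pos.2 ⟨i, hi⟩
      rwa [show c + A.card = c + 1 + (A.card - 1) by omega]
    · exact ih h.1 (subset_range_of_notMem hA hi)

/-- The table `b` consists of the complements of the sets of `a`. -/
def tablesMirror : ℕ → ℕ → ℕ → Bool
  | 0, a, b => a.testBit 0 == b.testBit 0
  | i + 1, a, b => tablesMirror i a (b >>> 2 ^ i) && tablesMirror i (a >>> 2 ^ i) b

theorem tablesMirror_spec {i a b : ℕ} (h : tablesMirror i a b = true) {A : Finset ℕ}
    (hA : A ⊆ range i) : a.testBit (bitCode A) = b.testBit (bitCode (range i \ A)) := by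
  induction i generalizing a b A with
  | zero =>
    have hA : A = ∅ := by simpa using hA
    subst hA
    exact beq_iff_eq.1 h
  | succ i ih =>
    rw [tablesMirror, Bool.and_eq_true] at h
    by_cases hi : i ∈ A
    · have := ih h.2 (erase_subset_range hA)
      rw [Nat.testBit_shiftRight, ← bitCode_eq_add_erase hi] at this
      rw [this]
      congr 2
      ext z
      simp only [mem_sdiff, mem_range, mem_erase]
      by_cases hz : z = i
      · subst hz; simp [hi]
      · have : z < i + 1 ↔ z < i := by omega
        simp [hz, this]
    · have := ih h.1 (subset_range_of_notMem hA hi)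
      rw [Nat.testBit_shiftRight] at this
      rw [this, range_add_one, insert_sdiff_of_notMem _ hi, bitCode_insert (by simp)]

/-- The coloring of the subsets of `Fin n` given by a table. -/
def tableColoring (n a : ℕ) (A : Finset (Fin n)) : ZMod 2 :=
  if a.testBit (bitCode (A.map Fin.valEmbedding)) then 1 else 0

theorem Finset.map_valEmbedding_subset_range {n : ℕ} (A : Finset (Fin n)) :
    A.map Fin.valEmbedding ⊆ range n := fun x hx => by
  obtain ⟨y, -, rfl⟩ := mem_map.1 hx
  exact mem_range.2 y.2

theorem Finset.map_valEmbedding_compl {n : ℕ} (A : Finset (Fin n)) :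
    Aᶜ.map Fin.valEmbedding = range n \ A.map Fin.valEmbedding := by
  ext z
  simp only [mem_map, mem_compl, mem_sdiff, mem_range]
  constructor
  · rintro ⟨y, hy, rfl⟩
    refine ⟨y.2, ?_⟩
    rintro ⟨y', hy', h⟩
    exact hy (Fin.valEmbedding.injective h ▸ hy')
  · rintro ⟨hz, h⟩
    exact ⟨⟨z, hz⟩, fun h' => h ⟨_, h', rfl⟩, rfl⟩

theorem tableColoring_compl_of_mirror_self {n a : ℕ} (h : tablesMirror n a a = true)
    (A : Finset (Fin n)) : tableColoring n a Aᶜ = tableColoring n a A := by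
  rw [tableColoring, tableColoring, map_valEmbedding_compl,
    ← tablesMirror_spec h (map_valEmbedding_subset_range A)]

theorem tableColoring_compl_of_mirror {n d a b : ℕ} (h : tablesMirror n b a = true)
    (hp : tablesPartition d n 0 a b = true) {A : Finset (Fin n)} (hA : A.card = d) :
    tableColoring n a Aᶜ = tableColoring n a A + 1 := by
  rw [tableColoring, tableColoring, map_valEmbedding_compl,
    ← tablesMirror_spec h (map_valEmbedding_subset_range A),
    (tablesPartition_spec hp (map_valEmbedding_subset_range A)).1 (by rw [zero_add, card_map, hA])]
  generalize b.testBit _ = v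
  revert v; decide

/-- `slicesMet` ignores cardinalities, but by `tablesPartition` both tables mark only `d`-sets, so
every set it finds has the right size. Table `a` yields color 1 and table `b` color 0. -/
theorem mixed_tableColoring {d a b : ℕ} (ha : slicesMet (2 * d) d 0 1 a = true)
    (hb : slicesMet (2 * d) d 0 1 b = true) (hp : tablesPartition d (2 * d) 0 a b = true) :
    Mixed d (tableColoring (2 * d) a) := by
  intro S Y hSY hY hS0 hSd c
  have key : ∀ t, slicesMet (2 * d) d 0 1 t = true → ∃ T ⊆ Y,
      t.testBit (bitCode ((S ∪ T).map Fin.valEmbedding)) = true := by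
    intro t ht
    have hSY' : Disjoint (S.map Fin.valEmbedding) (Y.map Fin.valEmbedding) :=
      (disjoint_map _).2 hSY
    obtain ⟨T, hT, hbit⟩ := exists_testBit_of_slicesMet (q := 0) ht
      (map_valEmbedding_subset_range S) (map_valEmbedding_subset_range Y) hSY'
      ((card_map _).trans hY) (by simp)
      (by
        rw [zero_add, ← bitCode_empty]
        refine bitCode_injective.ne fun h => ?_
        rw [map_eq_empty] at h
        simp [h] at hS0)
      (by
        rw [zero_add, zero_add, ← map_valEmbedding_compl]
        refine bitCode_injective.ne fun h => ?_
        have := congrArg card h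
        rw [card_map, card_map, card_compl, Fintype.card_fin] at this
        omega)
    obtain ⟨T, hT', rfl⟩ := subset_map_iff.1 hT
    refine ⟨T, hT', ?_⟩
    rw [map_union, ← hbit, zero_add]
    congr 1
    exact sum_union ((disjoint_map _).2 (hSY.mono_right hT'))
  have hcard : ∀ T ⊆ Y, (S ∪ T).card = S.card + T.card := fun T hT =>
    card_union_of_disjoint (hSY.mono_right hT)
  rcases ZMod.eq_or_eq_add_one_of_two c 1 with rfl | rfl
  · obtain ⟨T, hT, hbit⟩ := key a ha
    refine ⟨T, hT, ?_, if_pos hbit⟩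
    have := tablesPartition_spec hp (map_valEmbedding_subset_range (S ∪ T))
    rw [hbit, card_map, hcard T hT, zero_add] at this
    by_contra hne
    simpa using (this.2 hne).1
  · obtain ⟨T, hT, hbit⟩ := key b hb
    have := tablesPartition_spec hp (map_valEmbedding_subset_range (S ∪ T))
    rw [hbit, card_map, hcard T hT, zero_add] at this
    have hd : S.card + T.card = d := by
      by_contra hne
      simpa using (this.2 hne).2
    refine ⟨T, hT, hd, ?_⟩
    rw [tableColoring, this.1 hd]
    decide

/-- A table of half of the 6-subsets of a 12-set. -/
def sixTable : ℕ :=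
  0x1200000000000000120000001601060200000000000000001200000016011216000001011200061240000206400448608000000000000000160000001601061240000000160016064001120600102008800001010201060240010202000020088001000028026048000248608060800000000000010001011200010112001606000000000600020640011202400048608000000016001206400106120010200880010410281220080012200800288080000001010401000020001400280228288000160220024860800248600048008000000612080260608002604800480000000060488048000000480000000000000000000001000101040001010400041068000101040104102800101028062008800000010401100428001004281228008000020228026840801268680048000000000000020106122001061220026048000006126016200800140820800080800000100468142820001408288008808000160800802000000020000000000000000001001000100428010410280268680000061268162828001428080028000000000612601608200014080080008080001420080000808000008080008000000000100448140828801420088020000000160020000080800020808000800000001628080000808000208080008000000020808000800000008000000000000000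

/-- The complementary table to `sixTable`. -/
def sixTableCompl : ℕ :=
  0x1000000010001010400000001000101040001010000101468000000010001010400010100000400680000000401100428011410281220080000000001000101000001010000100428000101000100102800041068064860000000001400101428001414681648600000161640140820801420080008008000000000000000000400000004010010680001011001141028000414281620080000010100010410280010046806486000001206400448608004486080400000000000001200161648010216401440400001001448142008001420088020800000011004601408080014082080208080001608200020808000208080008000000000000000000000120000001201120600000000120012064001060640104860000001001200061240010612400440680001141440140028000400008020808000000101140010044800100448140820800110040800486080026048006800000001061200024048800260400060000000006068004880800048808000800000000000010601061240001206401400008001100400004040800240608040808000011004080060488002606800680000000248608068000000680000000000000001061220026040000248600048808000006848806800000048000000000000000040608068000000480000000000000048000000000000000000000000000000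

/-- A complement-closed table of 5-subsets of a 10-set. -/
def fiveTable : ℕ :=
  0x16000000160112060000000006001612400106160010200880000101120102060000061240044860800010046816082000162008000080800000010100001004680004106816200800010612200248600000604080488080000110040800686080024868006000000000604880680000006800000000000000

/-- The complementary table to `fiveTable`. -/
def fiveTableCompl : ℕ :=
  0x100010100000101000004106800010110010004280010006806486000000000040014106801100428122008000106120000604880004860806800000000000016010612000112060000486080001004481420088016082800200000000006126016000800142000800880800016082000008080000080800080000000

/-- There is an antisymmetric mixed coloring of the 6-subsets of a 12-set. -/
theorem exists_mixed_six : ∃ f : Finset (Fin 12) → ZMod 2,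
    (∀ A, A.card = 6 → f Aᶜ = f A + 1) ∧ Mixed 6 f := by
  have hp : tablesPartition 6 12 0 sixTable sixTableCompl = true := by decide +kernel
  exact ⟨tableColoring 12 sixTable,
    fun A hA => tableColoring_compl_of_mirror (b := sixTableCompl) (by decide +kernel) hp hA,
    mixed_tableColoring (d := 6) (b := sixTableCompl) (by decide +kernel) (by decide +kernel) hp⟩

/-- There is a symmetric mixed coloring of the 5-subsets of a 10-set. -/
theorem exists_symmetric_mixed_five : ∃ f : Finset (Fin 10) → ZMod 2,
    (∀ A, f Aᶜ = f A) ∧ Mixed 5 f :=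
  ⟨tableColoring 10 fiveTable, tableColoring_compl_of_mirror_self (by decide +kernel),
    mixed_tableColoring (d := 5) (b := fiveTableCompl) (by decide +kernel) (by decide +kernel)
      (by decide +kernel)⟩

end BitTables

/-! ### The case `d = 4`: an explicit family on 7 points -/

section ShatterTables

open Finset

/-- The table `t` of subsets of `{0, …, i - 1}` shatters `X ∩ {0, …, i - 1}`. -/
def tableShatters : ℕ → Finset ℕ → ℕ → Bool
  | 0, _, t => t.testBit 0
  | i + 1, X, t => if i ∈ X then tableShatters i X t && tableShatters i X (t >>> 2 ^ i)
    else tableShatters i X (t ||| t >>> 2 ^ i)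

/-- Split the members by whether they contain `i`. If `i ∈ X`, each half must shatter the rest of
`X`; if `i ∉ X`, the point is forgotten by merging the halves. -/
theorem tableShatters_iff {i : ℕ} {X : Finset ℕ} {t : ℕ} : tableShatters i X t = true ↔
    ∀ P ⊆ X ∩ range i, ∃ A ⊆ range i, X ∩ A = P ∧ t.testBit (bitCode A) = true := by
  induction i generalizing t with
  | zero => simp [tableShatters, bitCode_empty]
  | succ i ih =>
    have hmono : range i ⊆ range (i + 1) := range_subset_range.2 (Nat.le_succ i)
    have hi : i ∈ range (i + 1) := self_mem_range_succ i
    rw [tableShatters]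
    split_ifs with hiX
    · rw [Bool.and_eq_true, ih, ih]
      constructor
      · rintro ⟨h0, h1⟩ P hP
        by_cases hiP : i ∈ P
        · obtain ⟨A, hA, hXA, hbit⟩ := h1 (P.erase i) (subset_inter
            ((erase_subset _ _).trans (hP.trans inter_subset_left))
            (erase_subset_range (hP.trans inter_subset_right)))
          have hiA : i ∉ A := fun h => by simpa using hA h
          refine ⟨insert i A, insert_subset hi (hA.trans hmono), ?_, ?_⟩
          · rw [inter_insert_of_mem hiX, hXA, insert_erase hiP]
          · rwa [bitCode_insert hiA, ← Nat.testBit_shiftRight]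
        · obtain ⟨A, hA, hXA, hbit⟩ := h0 P (subset_inter (hP.trans inter_subset_left)
            (subset_range_of_notMem (hP.trans inter_subset_right) hiP))
          exact ⟨A, hA.trans hmono, hXA, hbit⟩
      · refine fun h => ⟨fun P hP => ?_, fun P hP => ?_⟩
        · obtain ⟨A, hA, hXA, hbit⟩ := h P (hP.trans (inter_subset_inter_left hmono))
          refine ⟨A, subset_range_of_notMem hA fun hiA => ?_, hXA, hbit⟩
          have := (mem_inter.1 (hP (hXA ▸ mem_inter.2 ⟨hiX, hiA⟩))).2
          simp at this
        · have hiP : i ∉ P := fun hiP => by simpa using (mem_inter.1 (hP hiP)).2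
          obtain ⟨A, hA, hXA, hbit⟩ := h (insert i P) (insert_subset (mem_inter.2 ⟨hiX, hi⟩)
            (hP.trans (inter_subset_inter_left hmono)))
          have hiA : i ∈ A := (mem_inter.1 (hXA ▸ mem_insert_self i P)).2
          refine ⟨A.erase i, erase_subset_range hA, ?_, ?_⟩
          · rw [inter_erase, hXA, erase_insert hiP]
          · rwa [Nat.testBit_shiftRight, ← bitCode_eq_add_erase hiA]
    · have hinter : X ∩ range (i + 1) = X ∩ range i := by
        rw [range_add_one, inter_insert_of_notMem hiX]
      rw [ih, hinter]
      refine forall₂_congr fun P hP => ⟨?_, ?_⟩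
      · rintro ⟨A, hA, hXA, hbit⟩
        rw [Nat.testBit_or, Bool.or_eq_true, Nat.testBit_shiftRight] at hbit
        rcases hbit with hbit | hbit
        · exact ⟨A, hA.trans hmono, hXA, hbit⟩
        · have hiA : i ∉ A := fun h => by simpa using hA h
          refine ⟨insert i A, insert_subset hi (hA.trans hmono), ?_, ?_⟩
          · rw [inter_insert_of_notMem hiX, hXA]
          · rwa [bitCode_insert hiA]
      · rintro ⟨A, hA, hXA, hbit⟩
        by_cases hiA : i ∈ A
        · refine ⟨A.erase i, erase_subset_range hA, ?_, ?_⟩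
          · rw [inter_erase, hXA, erase_eq_of_notMem]
            exact fun hiP => hiX (mem_inter.1 (hP hiP)).1
          · rw [Nat.testBit_or, Nat.testBit_shiftRight, ← bitCode_eq_add_erase hiA, hbit,
              Bool.or_true]
        · exact ⟨A, subset_range_of_notMem hA hiA, hXA, by rw [Nat.testBit_or, hbit, Bool.true_or]⟩

/-- The family of subsets of `Fin n` given by a table. -/
def tableFamily (n t : ℕ) : Finset (Finset (Fin n)) :=
  univ.filter fun A => t.testBit (bitCode (A.map Fin.valEmbedding)) = true

theorem mem_tableFamily {n t : ℕ} {A : Finset (Fin n)} :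
    A ∈ tableFamily n t ↔ t.testBit (bitCode (A.map Fin.valEmbedding)) = true := by
  simp [tableFamily]

theorem shatters_tableFamily_iff {n t : ℕ} {X : Finset (Fin n)} :
    (tableFamily n t).Shatters X ↔ tableShatters n (X.map Fin.valEmbedding) t = true := by
  have hrange : ∀ A ⊆ range n, ∃ B : Finset (Fin n), A = B.map Fin.valEmbedding := fun A hA => by
    have : A ⊆ (univ : Finset (Fin n)).map Fin.valEmbedding := fun x hx =>
      mem_map.2 ⟨⟨x, mem_range.1 (hA hx)⟩, mem_univ _, rfl⟩
    obtain ⟨B, -, hB⟩ := subset_map_iff.1 this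
    exact ⟨B, hB⟩
  rw [tableShatters_iff, inter_eq_left.2 (map_valEmbedding_subset_range X)]
  constructor
  · intro h P hP
    obtain ⟨Q, hQ, rfl⟩ := subset_map_iff.1 hP
    obtain ⟨A, hA, hXA⟩ := h hQ
    exact ⟨A.map Fin.valEmbedding, map_valEmbedding_subset_range A, by rw [← map_inter, hXA],
      mem_tableFamily.1 hA⟩
  · intro h Q hQ
    obtain ⟨A, hA, hXA, hbit⟩ := h _ (map_subset_map.2 hQ)
    obtain ⟨B, rfl⟩ := hrange A hA
    rw [← map_inter] at hXA
    exact ⟨B, mem_tableFamily.2 hbit, map_injective _ hXA⟩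

theorem insert_tableFamily {n t : ℕ} (B : Finset (Fin n)) : insert B (tableFamily n t) =
    tableFamily n (t ||| 1 <<< bitCode (B.map Fin.valEmbedding)) := by
  ext A
  rw [mem_insert, mem_tableFamily, mem_tableFamily, Nat.testBit_or, Bool.or_eq_true, or_comm,
    Nat.one_shiftLeft, Nat.testBit_two_pow, decide_eq_true_iff, bitCode_injective.eq_iff,
    (map_injective _).eq_iff, eq_comm (a := A)]

/-- A table of subsets of a 7-set which shatters no 4-set. -/
def fourTable : ℕ := 0x8010013b8d8004104904024000219880

theorem tableShatters_fourTable :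
    ∀ X ∈ (range 7).powersetCard 4, tableShatters 7 X fourTable = false := by
  decide +kernel

/-- This is the condition on the duplicated point `v = 6` in `satVC_le_card_not_forbids`. -/
theorem tableShatters_insert_fourTable :
    ∀ B ∈ (range 6).powerset, ∃ X ∈ (range 7).powersetCard 4,
      tableShatters 7 X (fourTable ||| 1 <<< bitCode B) = true ∨
      tableShatters 7 X (fourTable ||| 1 <<< bitCode (insert 6 B)) = true := by
  decide +kernel

/-- No count of non-forbidden sets is needed: a 7-set has only `2 ^ 7 ≤ 4 ^ 4` subsets. -/
theorem satVC_three_le {n : ℕ} (hn : 7 ≤ n) : satVC n 3 ≤ 4 ^ 4 := by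
  classical
  refine (satVC_le_card_not_forbids (d := 4) (n := n) (by norm_num) (tableFamily 7 fourTable)
    (6 : Fin 7) (by simpa using hn) ?_ ?_).trans ?_
  · intro X hX h
    rw [shatters_tableFamily_iff, tableShatters_fourTable _ (mem_powersetCard.2
      ⟨map_valEmbedding_subset_range X, (card_map _).trans hX⟩)] at h
    exact Bool.false_ne_true h
  · intro B hB
    have hB6 : B.map Fin.valEmbedding ∈ (range 6).powerset := mem_powerset.2 fun x hx => by
      obtain ⟨y, hy, rfl⟩ := mem_map.1 hx
      have h6 : y ≠ 6 := fun h => hB (h ▸ hy)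
      have := y.2
      have : (y : ℕ) ≠ 6 := fun h => h6 (Fin.ext h)
      exact mem_range.2 (show (y : ℕ) < 6 by omega)
    obtain ⟨X, hX, h⟩ := tableShatters_insert_fourTable _ hB6
    obtain ⟨hXr, hXc⟩ := mem_powersetCard.1 hX
    have : X ⊆ (univ : Finset (Fin 7)).map Fin.valEmbedding := fun x hx =>
      mem_map.2 ⟨⟨x, mem_range.1 (hXr hx)⟩, mem_univ _, rfl⟩
    obtain ⟨Z, -, rfl⟩ := subset_map_iff.1 this
    rw [card_map] at hXc
    refine h.imp (fun h => ⟨Z, hXc, ?_⟩) (fun h => ⟨Z, hXc, ?_⟩)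
    · rwa [insert_tableFamily, shatters_tableFamily_iff]
    · rw [insert_tableFamily, shatters_tableFamily_iff, map_insert]
      exact h
  · have h1 := card_filter_le (univ : Finset (Finset (Fin 7)))
      fun B => ¬ Forbids 4 (tableFamily 7 fourTable) B
    rw [card_univ, Fintype.card_finset, Fintype.card_fin] at h1
    exact_mod_cast h1.trans (by norm_num)

end ShatterTables

/-! ### Gluing mixed colorings along a partition of the ground set -/

section Gluing

open Finset

variable {α : Type*} [DecidableEq α]

/-- `Mixed` for the coloring `c` of the `d`-subsets of `V`. -/
def MixedOn (V : Finset α) (d : ℕ) (c : Finset α → ZMod 2) : Prop :=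
  ∀ S Y, S ⊆ V → Y ⊆ V → Disjoint S Y → Y.card = d → 0 < S.card → S.card < d →
    ∀ e, ∃ A, S ⊆ A ∧ A ⊆ S ∪ Y ∧ A.card = d ∧ c A = e

/-- All of `Y ∩ V` lies on one side of `W`; `l` is 1 inside `W` and 0 outside. -/
theorem exists_card_inter_eq_mul {V W Y : Finset α}
    (hY : ¬ ∃ p ∈ Y, ∃ q ∈ Y, p ∈ V ∧ q ∈ V ∧ p ∈ W ∧ q ∉ W) :
    ∃ l : ℕ, ∀ T ⊆ Y, (T ∩ W ∩ V).card = l * (T ∩ V).card := by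
  by_cases h : ∃ p ∈ Y, p ∈ V ∧ p ∈ W
  · obtain ⟨p, hp, hpV, hpW⟩ := h
    refine ⟨1, fun T hT => ?_⟩
    rw [one_mul]
    congr 1
    ext x
    rw [mem_inter, mem_inter, mem_inter]
    refine ⟨fun h => ⟨h.1.1, h.2⟩, fun h => ⟨⟨h.1, ?_⟩, h.2⟩⟩
    by_contra hxW
    exact hY ⟨p, hp, x, hT h.1, hpV, h.2, hpW, hxW⟩
  · refine ⟨0, fun T hT => ?_⟩
    rw [zero_mul, card_eq_zero, eq_empty_iff_forall_notMem]
    intro x hx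
    rw [mem_inter, mem_inter] at hx
    exact h ⟨x, hT hx.1.1, hx.2, hx.1.2⟩

variable [Fintype α]

theorem Finset.card_inter_add_card_inter_compl (A V : Finset α) :
    (A ∩ V).card + (A ∩ Vᶜ).card = A.card := by
  rw [← sdiff_eq_inter_compl, card_inter_add_card_sdiff]

theorem Finset.exists_between_card_inter {L M V : Finset α} (hLM : L ⊆ M) {a b : ℕ}
    (h1 : (L ∩ V).card ≤ a) (h2 : a ≤ (M ∩ V).card) (h3 : (L ∩ Vᶜ).card ≤ b)
    (h4 : b ≤ (M ∩ Vᶜ).card) :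
    ∃ A, L ⊆ A ∧ A ⊆ M ∧ (A ∩ V).card = a ∧ (A ∩ Vᶜ).card = b := by
  obtain ⟨P, hLP, hPM, hP⟩ := exists_subsuperset_card_eq (inter_subset_inter_right hLM) h1 h2
  obtain ⟨Q, hLQ, hQM, hQ⟩ := exists_subsuperset_card_eq (inter_subset_inter_right hLM) h3 h4
  have hPV := hPM.trans inter_subset_right
  have hQV := hQM.trans inter_subset_right
  refine ⟨P ∪ Q, fun x hx => ?_, union_subset (hPM.trans inter_subset_left)
    (hQM.trans inter_subset_left), ?_, ?_⟩
  · by_cases hxV : x ∈ V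
    · exact mem_union_left _ (hLP (mem_inter.2 ⟨hx, hxV⟩))
    · exact mem_union_right _ (hLQ (mem_inter.2 ⟨hx, mem_compl.2 hxV⟩))
  · rw [← hP]
    congr 1
    ext x
    have h5 : x ∈ P → x ∈ V := fun h => hPV h
    have h6 : x ∈ Q → x ∉ V := fun h => mem_compl.1 (hQV h)
    rw [mem_inter, mem_union]
    tauto
  · rw [← hQ]
    congr 1
    ext x
    have h5 : x ∈ P → x ∈ V := fun h => hPV h
    have h6 : x ∈ Q → x ∉ V := fun h => mem_compl.1 (hQV h)
    rw [mem_inter, mem_union, mem_compl]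
    tauto

/-- `f` is glued from the colorings `c₁` and `c₂` of the `d₁`-subsets of `V` and of the `d₂`-subsets
of its complement. -/
structure IsGlued (d₁ d₂ : ℕ) (V W : Finset α) (c₁ c₂ : Finset α → ZMod 2) (g₁ g₂ : ℕ → ZMod 2)
    (f : Finset α → ZMod 2) : Prop where
  three_le_left : 3 ≤ d₁
  three_le_right : 3 ≤ d₂
  card_left : V.card = 2 * d₁
  card_right : Vᶜ.card = 2 * d₂
  card_inter_left : (V ∩ W).card = d₁
  card_inter_right : (Vᶜ ∩ W).card = d₂
  mixed_left : MixedOn V d₁ c₁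
  mixed_right : MixedOn Vᶜ d₂ c₂
  eq_add : ∀ A, (A ∩ V).card = d₁ → (A ∩ Vᶜ).card = d₂ → f A = c₁ (A ∩ V) + c₂ (A ∩ Vᶜ)
  eq_left : ∀ A, A.card = d₁ + d₂ → (A ∩ V).card ≠ d₁ → f A = (A ∩ W).card + g₁ (A ∩ V).card
  eq_right : ∀ A, A.card = d₁ + d₂ → (A ∩ V).card ≠ d₁ → f A = (A ∩ W).card + g₂ (A ∩ Vᶜ).card
  pattern_left : ∀ l c : ZMod 2, ∃ t : ℕ, 1 ≤ t ∧ t ≤ 3 ∧ l * t + g₁ (d₁ + t) ≠ c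
  pattern_right : ∀ l c : ZMod 2, ∃ t : ℕ, 1 ≤ t ∧ t ≤ 3 ∧ l * t + g₂ (d₂ + t) ≠ c

namespace IsGlued

variable {d₁ d₂ : ℕ} {V W : Finset α} {c₁ c₂ : Finset α → ZMod 2} {g₁ g₂ : ℕ → ZMod 2}
  {f : Finset α → ZMod 2} {S Y : Finset α} {c : ZMod 2}

theorem symm (h : IsGlued d₁ d₂ V W c₁ c₂ g₁ g₂ f) : IsGlued d₂ d₁ Vᶜ W c₂ c₁ g₂ g₁ f where
  three_le_left := h.three_le_right
  three_le_right := h.three_le_left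
  card_left := h.card_right
  card_right := by rw [compl_compl, h.card_left]
  card_inter_left := h.card_inter_right
  card_inter_right := by rw [compl_compl, h.card_inter_left]
  mixed_left := h.mixed_right
  mixed_right := by rw [compl_compl]; exact h.mixed_left
  eq_add A hA hA' := by
    rw [compl_compl] at hA' ⊢
    rw [h.eq_add A hA' hA, add_comm]
  eq_left A hA hA' := h.eq_right A (by omega) (by
    have := card_inter_add_card_inter_compl A V
    omega)
  eq_right A hA hA' := by
    rw [compl_compl]
    refine h.eq_left A (by omega) ?_
    have := card_inter_add_card_inter_compl A V
    omega
  pattern_left := h.pattern_right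
  pattern_right := h.pattern_left

/-- Exchanging `p` and `q` preserves the layer `|A ∩ V|` and changes `|A ∩ W|` by one, so it changes
the color outside the middle layer `d₁`. The strict bounds on `a` leave room to include `p` and omit
`q`. -/
theorem card_eq_of_exchange (h : IsGlued d₁ d₂ V W c₁ c₂ g₁ g₂ f) (hSY : Disjoint S Y)
    (hc : ∀ A, S ⊆ A → A ⊆ S ∪ Y → A.card = d₁ + d₂ → f A = c) {p q : α} (hp : p ∈ Y) (hq : q ∈ Y)
    (hpV : p ∈ V) (hqV : q ∈ V) (hpW : p ∈ W) (hqW : q ∉ W) {a b : ℕ} (hab : a + b = d₁ + d₂)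
    (h1 : (S ∩ V).card < a) (h2 : a < (S ∩ V).card + (Y ∩ V).card) (h3 : (S ∩ Vᶜ).card ≤ b)
    (h4 : b ≤ (S ∩ Vᶜ).card + (Y ∩ Vᶜ).card) : a = d₁ := by
  have hpq : p ≠ q := fun h => hqW (h ▸ hpW)
  have hpS : p ∉ S := fun h => disjoint_left.1 hSY h hp
  have hqS : q ∉ S := fun h => disjoint_left.1 hSY h hq
  obtain ⟨A, hLA, hAM, hAa, hAb⟩ := exists_between_card_inter (L := insert p S)
    (M := (S ∪ Y).erase q) (V := V) (a := a) (b := b)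
    (by
      refine insert_subset (mem_erase.2 ⟨hpq, mem_union_right _ hp⟩) fun x hx =>
        mem_erase.2 ⟨fun h => hqS (h ▸ hx), mem_union_left _ hx⟩)
    (by
      rw [insert_inter_of_mem hpV, card_insert_of_notMem (fun h => hpS (mem_inter.1 h).1)]
      omega)
    (by
      rw [erase_inter, card_erase_of_mem (mem_inter.2 ⟨mem_union_right _ hq, hqV⟩),
        union_inter_distrib_right, card_union_of_disjoint
          (hSY.mono inter_subset_left inter_subset_left)]
      omega)
    (by rw [insert_inter_of_notMem (fun h => mem_compl.1 h hpV)]; omega)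
    (by
      rw [erase_inter, erase_eq_of_notMem (fun h => mem_compl.1 (mem_inter.1 h).2 hqV),
        union_inter_distrib_right, card_union_of_disjoint
          (hSY.mono inter_subset_left inter_subset_left)]
      omega)
  have hAd : A.card = d₁ + d₂ := by
    have := card_inter_add_card_inter_compl A V
    omega
  have hpA : p ∈ A := hLA (mem_insert_self _ _)
  have hqA : q ∉ A := fun h => notMem_erase _ _ (hAM h)
  have hSA : S ⊆ A := (subset_insert _ _).trans hLA
  have hAS : A ⊆ S ∪ Y := hAM.trans (erase_subset _ _)
  have hswap := (card_swap hpA hqA).trans hAd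
  have hV := card_swap_inter hpA hqA V
  have hW := card_swap_inter hpA hqA W
  rw [if_pos hpV, if_pos hqV] at hV
  rw [if_pos hpW, if_neg hqW] at hW
  by_contra hne
  have e1 := hc A hSA hAS hAd
  have e2 := hc _ (subset_swap hSY hp hSA) (swap_subset hq hAS) hswap
  rw [h.eq_left A hAd (by omega)] at e1
  rw [h.eq_left _ hswap (by omega), add_right_cancel hV] at e2
  have e3 := add_right_cancel (e1.trans e2.symm)
  rw [← add_zero (A ∩ W).card, ← hW, Nat.cast_add, Nat.cast_one] at e3
  exact one_ne_zero (add_eq_left.1 e3)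

/-- With the part `B` outside `V` fixed, the color on the middle layer is `c₁` plus a constant, and
`c₁` is mixed. -/
theorem false_of_mid (h : IsGlued d₁ d₂ V W c₁ c₂ g₁ g₂ f)
    (hc : ∀ A, S ⊆ A → A ⊆ S ∪ Y → A.card = d₁ + d₂ → f A = c) {B S' Y' : Finset α}
    (hSB : S ∩ Vᶜ ⊆ B) (hBS : B ⊆ (S ∪ Y) ∩ Vᶜ) (hB : B.card = d₂) (hS' : S ∩ V ⊆ S')
    (hSV : S' ⊆ (S ∪ Y) ∩ V) (hYV : Y' ⊆ (S ∪ Y) ∩ V) (hSY : Disjoint S' Y') (hY' : Y'.card = d₁)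
    (h0 : 0 < S'.card) (h1 : S'.card < d₁) : False := by
  obtain ⟨A, hSA, hAS, hA, hcA⟩ := h.mixed_left S' Y' (hSV.trans inter_subset_right)
    (hYV.trans inter_subset_right) hSY hY' h0 h1 (c + 1 - c₂ B)
  have hAV : A ⊆ (S ∪ Y) ∩ V := hAS.trans (union_subset hSV hYV)
  have hA1 : (A ∪ B) ∩ V = A := by
    ext x
    have h5 : x ∈ A → x ∈ V := fun h => (mem_inter.1 (hAV h)).2
    have h6 : x ∈ B → x ∉ V := fun h => mem_compl.1 (mem_inter.1 (hBS h)).2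
    rw [mem_inter, mem_union]
    tauto
  have hA2 : (A ∪ B) ∩ Vᶜ = B := by
    ext x
    have h5 : x ∈ A → x ∈ V := fun h => (mem_inter.1 (hAV h)).2
    have h6 : x ∈ B → x ∉ V := fun h => mem_compl.1 (mem_inter.1 (hBS h)).2
    rw [mem_inter, mem_union, mem_compl]
    tauto
  have e1 := hc (A ∪ B) (fun x hx => ?_) (union_subset (hAV.trans inter_subset_left)
    (hBS.trans inter_subset_left)) (by
      rw [← card_inter_add_card_inter_compl (A ∪ B) V, hA1, hA2, hA, hB])
  · rw [h.eq_add _ (by rw [hA1, hA]) (by rw [hA2, hB]), hA1, hA2, hcA, sub_add_cancel] at e1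
    exact one_ne_zero (add_eq_left.1 e1)
  · by_cases hxV : x ∈ V
    · exact mem_union_left _ (hSA (hS' (mem_inter.2 ⟨hx, hxV⟩)))
    · exact mem_union_right _ (hSB (mem_inter.2 ⟨hx, mem_compl.2 hxV⟩))

/-- Each side of `W` has only `d₁` points in `V`. -/
theorem exists_exchange (h : IsGlued d₁ d₂ V W c₁ c₂ g₁ g₂ f) (hY : d₁ < (Y ∩ V).card) :
    ∃ p ∈ Y, ∃ q ∈ Y, p ∈ V ∧ q ∈ V ∧ p ∈ W ∧ q ∉ W := by
  have h1 : (V ∩ Wᶜ).card = d₁ := by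
    have := card_inter_add_card_inter_compl V W
    have := h.card_left
    have := h.card_inter_left
    omega
  obtain ⟨p, hp, hpW⟩ : ∃ p ∈ Y ∩ V, p ∉ V ∩ Wᶜ := by
    by_contra! hcon
    have := card_le_card (show Y ∩ V ⊆ V ∩ Wᶜ from hcon)
    omega
  obtain ⟨q, hq, hqW⟩ : ∃ q ∈ Y ∩ V, q ∉ V ∩ W := by
    by_contra! hcon
    have := card_le_card (show Y ∩ V ⊆ V ∩ W from hcon)
    have := h.card_inter_left
    omega
  rw [mem_inter] at hp hq
  rw [mem_inter, mem_compl] at hpW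
  rw [mem_inter] at hqW
  exact ⟨p, hp.1, q, hq.1, hp.2, hq.2, by tauto, by tauto⟩

/-- All sets of the slice lie in one layer. An exchange exists in `V`, so this is the middle layer,
where `c₁` is mixed. -/
theorem false_of_inter_compl_eq_empty (h : IsGlued d₁ d₂ V W c₁ c₂ g₁ g₂ f) (hSY : Disjoint S Y)
    (hY : Y.card = d₁ + d₂) (hS0 : 0 < S.card) (hSd : S.card < d₁ + d₂)
    (hc : ∀ A, S ⊆ A → A ⊆ S ∪ Y → A.card = d₁ + d₂ → f A = c) (hYV : (Y ∩ Vᶜ).card = 0) :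
    False := by
  have h1 := h.three_le_left
  have h2 := h.three_le_right
  have hY' := card_inter_add_card_inter_compl Y V
  have hS' := card_inter_add_card_inter_compl S V
  obtain ⟨p, hp, q, hq, hpV, hqV, hpW, hqW⟩ := h.exists_exchange (Y := Y) (by omega)
  have h3 := h.card_eq_of_exchange hSY hc hp hq hpV hqV hpW hqW
    (a := d₁ + d₂ - (S ∩ Vᶜ).card) (b := (S ∩ Vᶜ).card) (by omega) (by omega) (by omega) (by omega)
    (by omega)
  have hYsub : Y ∩ V ⊆ (S ∪ Y) ∩ V := inter_subset_inter_right subset_union_right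
  by_cases hS1 : (S ∩ V).card = 0
  -- Mixedness needs a nonempty prescribed part, so `{p}` replaces the empty `S ∩ V`.
  · obtain ⟨Z, hZ, hZc⟩ := exists_subset_card_eq (s := (Y ∩ V).erase p) (n := d₁) (by
      rw [card_erase_of_mem (mem_inter.2 ⟨hp, hpV⟩)]; omega)
    refine h.false_of_mid hc Subset.rfl (inter_subset_inter_right subset_union_left) (by omega)
      (S' := {p}) (Y' := Z) ?_ ?_ (hZ.trans ((erase_subset _ _).trans hYsub)) ?_ hZc (by simp)
      (by rw [card_singleton]; omega)
    · rw [card_eq_zero.1 hS1]; exact empty_subset _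
    · exact singleton_subset_iff.2 (hYsub (mem_inter.2 ⟨hp, hpV⟩))
    · exact disjoint_singleton_left.2 fun h => notMem_erase _ _ (hZ h)
  · obtain ⟨Z, hZ, hZc⟩ := exists_subset_card_eq (s := Y ∩ V) (n := d₁) (by omega)
    exact h.false_of_mid hc Subset.rfl (inter_subset_inter_right subset_union_left) (by omega)
      (S' := S ∩ V) (Y' := Z) Subset.rfl (inter_subset_inter_right subset_union_left)
      (hZ.trans hYsub) (hSY.mono inter_subset_left (hZ.trans inter_subset_left)) hZc (by omega)
      (by omega)

/-- Without exchanges the color depends only on the layer `d₁ + t`, as a linear term in `t` plus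
`g₁`; by `pattern_left` no linear term makes this constant on `t = 1, 2, 3`. -/
theorem false_of_corner (h : IsGlued d₁ d₂ V W c₁ c₂ g₁ g₂ f) (hSY : Disjoint S Y)
    (hc : ∀ A, S ⊆ A → A ⊆ S ∪ Y → A.card = d₁ + d₂ → f A = c)
    (hY₁ : ¬ ∃ p ∈ Y, ∃ q ∈ Y, p ∈ V ∧ q ∈ V ∧ p ∈ W ∧ q ∉ W)
    (hY₂ : ¬ ∃ p ∈ Y, ∃ q ∈ Y, p ∈ Vᶜ ∧ q ∈ Vᶜ ∧ p ∈ W ∧ q ∉ W)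
    (hYV : (Y ∩ V).card = d₁) (hYVc : (Y ∩ Vᶜ).card = d₂)
    (hSV : (S ∩ V).card = d₁) (hSVc : (S ∩ Vᶜ).card = 0) : False := by
  have h1 := h.three_le_left
  have h2 := h.three_le_right
  obtain ⟨l₁, hl₁⟩ := exists_card_inter_eq_mul hY₁
  obtain ⟨l₂, hl₂⟩ := exists_card_inter_eq_mul hY₂
  -- Adding `t` points in `V` and `d₂ - t` outside gives `|S ∩ W| + l₁ t + l₂ (d₂ - t) + g₁ (d₁ +
  -- t)`; modulo 2 the coefficient of `t` is `l₁ + l₂`.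
  obtain ⟨t, ht1, ht3, hne⟩ := h.pattern_left (l₁ + l₂) (c - (S ∩ W).card - l₂ * d₂)
  obtain ⟨T, hT0, hTY, hTV, hTVc⟩ := exists_between_card_inter (V := V) (empty_subset Y)
    (a := t) (b := d₂ - t) (by simp) (by omega) (by simp) (by omega)
  have hdis : Disjoint S T := hSY.mono_right hTY
  have hAV : ((S ∪ T) ∩ V).card = d₁ + t := by
    rw [union_inter_distrib_right, card_union_of_disjoint
      (hdis.mono inter_subset_left inter_subset_left), hSV, hTV]
  have hTc := card_inter_add_card_inter_compl T V
  have hSc := card_inter_add_card_inter_compl S V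
  have hAc : (S ∪ T).card = d₁ + d₂ := by
    rw [card_union_of_disjoint hdis]; omega
  have hAW : ((S ∪ T) ∩ W).card = (S ∩ W).card + (l₁ * t + l₂ * (d₂ - t)) := by
    rw [union_inter_distrib_right, card_union_of_disjoint
      (hdis.mono inter_subset_left inter_subset_left),
      ← card_inter_add_card_inter_compl (T ∩ W) V, hl₁ T hTY, hl₂ T hTY, hTV, hTVc]
  have e := hc (S ∪ T) subset_union_left (union_subset_union_right hTY) hAc
  rw [h.eq_left _ hAc (by omega), hAV, hAW] at e
  refine hne ?_
  rw [← e]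
  push_cast [Nat.cast_sub (show t ≤ d₂ by omega)]
  have h2 : (2 : ZMod 2) = 0 := rfl
  linear_combination (l₂ * t : ZMod 2) * h2

/-- By pigeonhole `Y` has exactly `d₁` points in `V` and `d₂` outside. If `S` has a part of
intermediate size on either side, mixedness there applies; otherwise `S` fills half of one side and
misses the other. -/
theorem false_of_not_exchange (h : IsGlued d₁ d₂ V W c₁ c₂ g₁ g₂ f) (hSY : Disjoint S Y)
    (hY : Y.card = d₁ + d₂) (hS0 : 0 < S.card) (hSd : S.card < d₁ + d₂)
    (hc : ∀ A, S ⊆ A → A ⊆ S ∪ Y → A.card = d₁ + d₂ → f A = c)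
    (hY₁ : ¬ ∃ p ∈ Y, ∃ q ∈ Y, p ∈ V ∧ q ∈ V ∧ p ∈ W ∧ q ∉ W)
    (hY₂ : ¬ ∃ p ∈ Y, ∃ q ∈ Y, p ∈ Vᶜ ∧ q ∈ Vᶜ ∧ p ∈ W ∧ q ∉ W) : False := by
  have hYV : (Y ∩ V).card ≤ d₁ := by
    by_contra! hlt
    exact hY₁ (h.exists_exchange hlt)
  have hYVc : (Y ∩ Vᶜ).card ≤ d₂ := by
    by_contra! hlt
    exact hY₂ (h.symm.exists_exchange hlt)
  have hY' := card_inter_add_card_inter_compl Y V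
  have hS' := card_inter_add_card_inter_compl S V
  have hsum : ∀ U, (S ∩ U).card + (Y ∩ U).card ≤ U.card := fun U => by
    rw [← card_union_of_disjoint (hSY.mono inter_subset_left inter_subset_left)]
    exact card_le_card (union_subset inter_subset_right inter_subset_right)
  have hs1 := hsum V
  have hs2 := hsum Vᶜ
  rw [h.card_left] at hs1
  rw [h.card_right] at hs2
  have hfill : ∀ U m, (S ∩ U).card ≤ m → m ≤ (Y ∩ U).card →
      ∃ B, S ∩ U ⊆ B ∧ B ⊆ (S ∪ Y) ∩ U ∧ B.card = m := fun U m h1 h2 =>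
    exists_subsuperset_card_eq (inter_subset_inter_right subset_union_left) h1
      (h2.trans (card_le_card (inter_subset_inter_right subset_union_right)))
  have hSU : ∀ U, S ∩ U ⊆ (S ∪ Y) ∩ U := fun U => inter_subset_inter_right subset_union_left
  have hYU : ∀ U, Y ∩ U ⊆ (S ∪ Y) ∩ U := fun U => inter_subset_inter_right subset_union_right
  by_cases hcase1 : 0 < (S ∩ V).card ∧ (S ∩ V).card < d₁
  · obtain ⟨B, hSB, hBS, hB⟩ := hfill Vᶜ d₂ (by omega) (by omega)
    exact h.false_of_mid hc hSB hBS hB Subset.rfl (hSU V) (hYU V)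
      (hSY.mono inter_subset_left inter_subset_left) (by omega) hcase1.1 hcase1.2
  by_cases hcase2 : 0 < (S ∩ Vᶜ).card ∧ (S ∩ Vᶜ).card < d₂
  · obtain ⟨B, hSB, hBS, hB⟩ := hfill V d₁ (by omega) (by omega)
    refine h.symm.false_of_mid (fun A h1 h2 h3 => hc A h1 h2 (by omega))
      (by rwa [compl_compl]) (by rwa [compl_compl]) hB Subset.rfl (hSU Vᶜ) (hYU Vᶜ)
      (hSY.mono inter_subset_left inter_subset_left) (by omega) hcase2.1 hcase2.2
  by_cases hcase3 : (S ∩ Vᶜ).card = 0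
  · exact h.false_of_corner hSY hc hY₁ hY₂ (by omega) (by omega) (by omega) hcase3
  · exact h.symm.false_of_corner hSY (fun A h1 h2 h3 => hc A h1 h2 (by omega)) hY₂
      (by rwa [compl_compl]) (by omega) (by rw [compl_compl]; omega) (by omega)
      (by rw [compl_compl]; omega)

theorem false_of_card_inter_compl_eq (h : IsGlued d₁ d₂ V W c₁ c₂ g₁ g₂ f) (hSY : Disjoint S Y)
    (hY : Y.card = d₁ + d₂) (hS : S.card + 1 = d₁ + d₂)
    (hc : ∀ A, S ⊆ A → A ⊆ S ∪ Y → A.card = d₁ + d₂ → f A = c) (hSV : (S ∩ Vᶜ).card = d₂) :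
    False := by
  have h1 := h.three_le_left
  have hY' := card_inter_add_card_inter_compl Y V
  have hS' := card_inter_add_card_inter_compl S V
  have hsum : (S ∩ Vᶜ).card + (Y ∩ Vᶜ).card ≤ Vᶜ.card := by
    rw [← card_union_of_disjoint (hSY.mono inter_subset_left inter_subset_left)]
    exact card_le_card (union_subset inter_subset_right inter_subset_right)
  rw [h.card_right] at hsum
  obtain ⟨Z, hZ, hZc⟩ := exists_subset_card_eq (s := Y ∩ V) (n := d₁) (by omega)
  exact h.false_of_mid hc Subset.rfl (inter_subset_inter_right subset_union_left) hSV
    (S' := S ∩ V) (Y' := Z) Subset.rfl (inter_subset_inter_right subset_union_left)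
    (hZ.trans (inter_subset_inter_right subset_union_right))
    (hSY.mono inter_subset_left (hZ.trans inter_subset_left)) hZc (by omega) (by omega)

theorem not_exchange_of_card_add_one (h : IsGlued d₁ d₂ V W c₁ c₂ g₁ g₂ f) (hSY : Disjoint S Y)
    (hS : S.card + 1 = d₁ + d₂)
    (hc : ∀ A, S ⊆ A → A ⊆ S ∪ Y → A.card = d₁ + d₂ → f A = c)
    (hSV : (S ∩ Vᶜ).card ≠ d₂) :
    ¬ ∃ p ∈ Y, ∃ q ∈ Y, p ∈ V ∧ q ∈ V ∧ p ∈ W ∧ q ∉ W := by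
  rintro ⟨p, hp, q, hq, hpV, hqV, hpW, hqW⟩
  have hS' := card_inter_add_card_inter_compl S V
  have h2 : 1 < (Y ∩ V).card := one_lt_card.2 ⟨p, mem_inter.2 ⟨hp, hpV⟩, q,
    mem_inter.2 ⟨hq, hqV⟩, fun h => hqW (h ▸ hpW)⟩
  have := h.card_eq_of_exchange hSY hc hp hq hpV hqV hpW hqW
    (a := (S ∩ V).card + 1) (b := (S ∩ Vᶜ).card) (by omega) (by omega) (by omega) le_rfl (by omega)
  omega

theorem false_of_card_add_one (h : IsGlued d₁ d₂ V W c₁ c₂ g₁ g₂ f) (hSY : Disjoint S Y)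
    (hY : Y.card = d₁ + d₂) (hS : S.card + 1 = d₁ + d₂)
    (hc : ∀ A, S ⊆ A → A ⊆ S ∪ Y → A.card = d₁ + d₂ → f A = c) : False := by
  have h1 := h.three_le_left
  have hc' : ∀ A, S ⊆ A → A ⊆ S ∪ Y → A.card = d₂ + d₁ → f A = c :=
    fun A h1 h2 h3 => hc A h1 h2 (by omega)
  by_cases hSV : (S ∩ Vᶜ).card = d₂
  · exact h.false_of_card_inter_compl_eq hSY hY hS hc hSV
  by_cases hSV' : (S ∩ Vᶜᶜ).card = d₁
  · exact h.symm.false_of_card_inter_compl_eq hSY (by omega) (by omega) hc' hSV'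
  exact h.false_of_not_exchange hSY hY (by omega) (by omega) hc
    (h.not_exchange_of_card_add_one hSY hS hc hSV)
    (h.symm.not_exchange_of_card_add_one hSY (by omega) hc' hSV')

/-- A third point of `Y ∩ V` would allow exchanges in two consecutive layers, and both cannot be the
middle one. -/
theorem card_inter_eq_two_of_exchange (h : IsGlued d₁ d₂ V W c₁ c₂ g₁ g₂ f) (hSY : Disjoint S Y)
    (hY : Y.card = d₁ + d₂) (hS2 : 2 ≤ S.card) (hSd : S.card + 2 ≤ d₁ + d₂)
    (hc : ∀ A, S ⊆ A → A ⊆ S ∪ Y → A.card = d₁ + d₂ → f A = c) (hY0 : (Y ∩ Vᶜ).card ≠ 0)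
    (hex : ∃ p ∈ Y, ∃ q ∈ Y, p ∈ V ∧ q ∈ V ∧ p ∈ W ∧ q ∉ W) : (Y ∩ V).card = 2 := by
  obtain ⟨p, hp, q, hq, hpV, hqV, hpW, hqW⟩ := hex
  have hS' := card_inter_add_card_inter_compl S V
  have hY' := card_inter_add_card_inter_compl Y V
  have h2 : 1 < (Y ∩ V).card := one_lt_card.2 ⟨p, mem_inter.2 ⟨hp, hpV⟩, q,
    mem_inter.2 ⟨hq, hqV⟩, fun h => hqW (h ▸ hpW)⟩
  by_contra hne
  have key := fun a b => h.card_eq_of_exchange hSY hc hp hq hpV hqV hpW hqW (a := a) (b := b)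
  -- The least layer available: at least one point of `Y ∩ V` is added, and more if `Y ∩ Vᶜ` is too
  -- small for the remaining points.
  obtain ⟨a, ha⟩ : ∃ a, a = (S ∩ V).card + max 1 (d₁ + d₂ - S.card - (Y ∩ Vᶜ).card) := ⟨_, rfl⟩
  have k1 := key a (d₁ + d₂ - a) (by omega) (by omega) (by omega) (by omega) (by omega)
  have k2 := key (a + 1) (d₁ + d₂ - (a + 1)) (by omega) (by omega) (by omega) (by omega) (by omega)
  omega

/-- In the main case `2 ≤ |S| ≤ d₁ + d₂ - 2`, an exchange on one side leaves only two points of `Y`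
there. The other side then has enough points to force an exchange too, so `|Y| = 4`, although `d₁ +
d₂ ≥ 6`. -/
theorem mixed (h : IsGlued d₁ d₂ V W c₁ c₂ g₁ g₂ f)
    (hanti : ∀ A, A.card = d₁ + d₂ → f Aᶜ = f A + 1) : Mixed (d₁ + d₂) f := by
  refine mixed_of_not_const fun S Y hSY hY hS0 hSd c hc => ?_
  have h1 := h.three_le_left
  have h2 := h.three_le_right
  have hc' : ∀ A, S ⊆ A → A ⊆ S ∪ Y → A.card = d₂ + d₁ → f A = c :=
    fun A h1 h2 h3 => hc A h1 h2 (by omega)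
  have hα : Fintype.card α = 2 * (d₁ + d₂) := by
    rw [← card_add_card_compl V, h.card_left, h.card_right]; omega
  by_cases hS1 : S.card = 1
  -- Complementation carries this slice to the one with the same `Y` and prescribed part `(S ∪ Y)ᶜ`,
  -- which has `d₁ + d₂ - 1` points.
  · have hU : (S ∪ Y)ᶜ.card + 1 = d₁ + d₂ := by
      rw [card_compl, card_union_of_disjoint hSY, hα]; omega
    refine h.false_of_card_add_one (S := (S ∪ Y)ᶜ) (c := c + 1) ?_ hY hU fun A hA hA' hAd => ?_
    · exact disjoint_left.2 fun x hx hxY => mem_compl.1 hx (mem_union_right _ hxY)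
    · rw [← compl_compl A, hanti Aᶜ (by rw [card_compl, hα]; omega)]
      rw [hc Aᶜ (fun x hx => mem_compl.2 fun hxA => ?_) (fun x hx => by
          by_contra hxn
          exact mem_compl.1 hx (hA (mem_compl.2 hxn)))
        (by rw [card_compl, hα]; omega)]
      rcases mem_union.1 (hA' hxA) with h | h
      · exact mem_compl.1 h (mem_union_left _ hx)
      · exact disjoint_left.1 hSY hx h
  by_cases hSd' : S.card + 1 = d₁ + d₂
  · exact h.false_of_card_add_one hSY hY hSd' hc
  by_cases hY1 : (Y ∩ V).card = 0
  · exact h.symm.false_of_inter_compl_eq_empty hSY (by omega) hS0 (by omega) hc'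
      (by rwa [compl_compl])
  by_cases hY2 : (Y ∩ Vᶜ).card = 0
  · exact h.false_of_inter_compl_eq_empty hSY hY hS0 hSd hc hY2
  have hY' := card_inter_add_card_inter_compl Y V
  have key1 := h.card_inter_eq_two_of_exchange hSY hY (by omega) (by omega) hc hY2
  have key2 := h.symm.card_inter_eq_two_of_exchange hSY (by omega) (by omega) (by omega) hc'
    (by rwa [compl_compl])
  refine h.false_of_not_exchange hSY hY hS0 hSd hc (fun hex => ?_) (fun hex => ?_)
  · have h3 := key1 hex
    have h4 := key2 (h.symm.exists_exchange (by omega))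
    omega
  · have h3 := key2 hex
    have h4 := key1 (h.exists_exchange (by omega))
    omega

end IsGlued

end Gluing

/-! ### The glued coloring on 10 and `2d` points -/

section SumColoring

open Finset

variable {β γ : Type*} [DecidableEq β] [DecidableEq γ]

theorem Mixed.mixedOn_map_inl [Fintype β] {d : ℕ} {f : Finset β → ZMod 2} (hf : Mixed d f) :
    MixedOn (univ.map (Function.Embedding.inl : β ↪ β ⊕ γ)) d fun A => f A.toLeft := by
  intro S Y hS hY hSY hYd hS0 hSd e
  obtain ⟨S, -, rfl⟩ := subset_map_iff.1 hS
  obtain ⟨Y, -, rfl⟩ := subset_map_iff.1 hY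
  rw [card_map] at hYd hS0 hSd
  obtain ⟨A, hSA, hAS, hAd, hfA⟩ := hf.exists_between ((disjoint_map _).1 hSY) hYd hS0 hSd e
  refine ⟨A.map Function.Embedding.inl, map_subset_map.2 hSA, ?_, by rw [card_map, hAd], ?_⟩
  · rw [← map_union]; exact map_subset_map.2 hAS
  · dsimp only
    rw [← disjSum_empty, toLeft_disjSum, hfA]

theorem Mixed.mixedOn_map_inr [Fintype γ] {d : ℕ} {f : Finset γ → ZMod 2} (hf : Mixed d f) :
    MixedOn (univ.map (Function.Embedding.inr : γ ↪ β ⊕ γ)) d fun A => f A.toRight := by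
  intro S Y hS hY hSY hYd hS0 hSd e
  obtain ⟨S, -, rfl⟩ := subset_map_iff.1 hS
  obtain ⟨Y, -, rfl⟩ := subset_map_iff.1 hY
  rw [card_map] at hYd hS0 hSd
  obtain ⟨A, hSA, hAS, hAd, hfA⟩ := hf.exists_between ((disjoint_map _).1 hSY) hYd hS0 hSd e
  refine ⟨A.map Function.Embedding.inr, map_subset_map.2 hSA, ?_, by rw [card_map, hAd], ?_⟩
  · rw [← map_union]; exact map_subset_map.2 hAS
  · dsimp only
    rw [← empty_disjSum, toRight_disjSum, hfA]

theorem Finset.card_inter_map_inl [Fintype β] (A : Finset (β ⊕ γ)) :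
    (A ∩ univ.map Function.Embedding.inl).card = A.toLeft.card := by
  rw [← card_map (Function.Embedding.inl : β ↪ β ⊕ γ)]
  congr 1
  ext (x | x) <;> simp

theorem Finset.card_inter_map_inr [Fintype γ] (A : Finset (β ⊕ γ)) :
    (A ∩ univ.map Function.Embedding.inr).card = A.toRight.card := by
  rw [← card_map (Function.Embedding.inr : γ ↪ β ⊕ γ)]
  congr 1
  ext (x | x) <;> simp

variable [Fintype β] [Fintype γ]

/-- The correction term of `gluedColoring`. -/
def gluingSign (a : ℕ) : ZMod 2 := if a = 6 ∨ a ≤ 3 then 0 else 1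

/-- The coloring glued from a coloring of the 5-subsets of `β` and a coloring of the subsets
of `γ`. -/
def gluedColoring (f₁ : Finset β → ZMod 2) (f₂ : Finset γ → ZMod 2) (W A : Finset (β ⊕ γ)) :
    ZMod 2 :=
  if A.toLeft.card = 5 then f₁ A.toLeft + f₂ A.toRight
  else (A ∩ W).card + gluingSign A.toLeft.card

/-- On the middle layer only `f₂` changes. Elsewhere the parity is unchanged because `|W|` is even,
and `gluingSign` takes different values at `a` and `10 - a`. -/
theorem gluedColoring_compl {d : ℕ} {f₁ : Finset β → ZMod 2} {f₂ : Finset γ → ZMod 2}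
    {W A : Finset (β ⊕ γ)} (hβ : Fintype.card β = 10) (hW : Even W.card)
    (hf₁ : ∀ A, f₁ Aᶜ = f₁ A) (hf₂ : ∀ A, A.card = d → f₂ Aᶜ = f₂ A + 1) (hA : A.card = 5 + d) :
    gluedColoring f₁ f₂ W Aᶜ = gluedColoring f₁ f₂ W A + 1 := by
  have hl : Aᶜ.toLeft = A.toLeftᶜ := by ext x; simp
  have hr : Aᶜ.toRight = A.toRightᶜ := by ext x; simp
  have hcard := card_toLeft_add_card_toRight (u := A)
  have hle : A.toLeft.card ≤ 10 := hβ ▸ card_le_univ _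
  rw [gluedColoring, gluedColoring, hl, hr, card_compl, hβ]
  by_cases h5 : A.toLeft.card = 5
  · rw [if_pos (by omega), if_pos h5, hf₁, hf₂ _ (by omega), add_assoc]
  · rw [if_neg (by omega), if_neg h5]
    have h1 : (Aᶜ ∩ W).card + (A ∩ W).card = W.card := by
      rw [add_comm, inter_comm A, inter_comm Aᶜ, card_inter_add_card_inter_compl]
    have h2 : ((Aᶜ ∩ W).card : ZMod 2) + ((A ∩ W).card : ZMod 2) = 0 := by
      rw [← Nat.cast_add, h1]; exact (ZMod.natCast_eq_zero_iff_even).2 hW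
    have h3 : gluingSign (10 - A.toLeft.card) = gluingSign A.toLeft.card + 1 := by
      revert h5 hle
      generalize A.toLeft.card = a
      intro hle h5
      interval_cases a <;> first | rfl | exact absurd rfl h5
    rw [h3, eq_neg_of_add_eq_zero_left h2, ZMod.neg_eq_self_mod_two, add_assoc]

theorem mixed_gluedColoring {d : ℕ} {f₁ : Finset β → ZMod 2} {f₂ : Finset γ → ZMod 2}
    {W₁ : Finset β} {W₂ : Finset γ} (hβ : Fintype.card β = 10) (hγ : Fintype.card γ = 2 * d)
    (hd : 3 ≤ d) (hodd : Odd d) (hW₁ : W₁.card = 5) (hW₂ : W₂.card = d) (hf₁ : ∀ A, f₁ Aᶜ = f₁ A)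
    (hf₂ : ∀ A, A.card = d → f₂ Aᶜ = f₂ A + 1) (hm₁ : Mixed 5 f₁) (hm₂ : Mixed d f₂) :
    Mixed (5 + d) (gluedColoring f₁ f₂ (W₁.disjSum W₂)) := by
  have hV : (univ.map (Function.Embedding.inl : β ↪ β ⊕ γ))ᶜ =
      univ.map Function.Embedding.inr := by
    ext (x | x) <;> simp
  have hglued : IsGlued 5 d (univ.map (Function.Embedding.inl : β ↪ β ⊕ γ)) (W₁.disjSum W₂)
      (fun A => f₁ A.toLeft) (fun A => f₂ A.toRight) gluingSign (fun b => gluingSign (5 + d - b))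
      (gluedColoring f₁ f₂ (W₁.disjSum W₂)) :=
    { three_le_left := by norm_num
      three_le_right := hd
      card_left := by rw [card_map, card_univ, hβ]
      card_right := by rw [hV, card_map, card_univ, hγ]
      card_inter_left := by rw [inter_comm, card_inter_map_inl, toLeft_disjSum, hW₁]
      card_inter_right := by rw [inter_comm, hV, card_inter_map_inr, toRight_disjSum, hW₂]
      mixed_left := hm₁.mixedOn_map_inl
      mixed_right := hV ▸ hm₂.mixedOn_map_inr
      eq_add := fun A hA _ => by
        rw [card_inter_map_inl] at hA
        rw [gluedColoring, if_pos hA, hV]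
        congr 2
        · ext x; simp
        · ext x; simp
      eq_left := fun A _ hA => by
        rw [card_inter_map_inl] at hA ⊢
        rw [gluedColoring, if_neg hA]
      eq_right := fun A hAd hA => by
        have := card_toLeft_add_card_toRight (u := A)
        rw [card_inter_map_inl] at hA
        rw [hV, card_inter_map_inr, gluedColoring, if_neg hA,
          show 5 + d - A.toRight.card = A.toLeft.card by omega]
      -- The values 0, 1, 1 at 6, 7, 8 are neither constant nor alternating.
      pattern_left := by
        have : ∀ l c : ZMod 2, l * (1 : ℕ) + gluingSign 6 ≠ c ∨ l * (2 : ℕ) + gluingSign 7 ≠ c ∨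
          l * (3 : ℕ) + gluingSign 8 ≠ c := by decide
        intro l c
        rcases this l c with h | h | h
        exacts [⟨1, le_rfl, by norm_num, h⟩, ⟨2, by norm_num, by norm_num, h⟩,
          ⟨3, by norm_num, le_rfl, h⟩]
      -- Seen from the other side the layers are 4, 3, 2, with values 1, 0, 0.
      pattern_right := by
        have : ∀ l c : ZMod 2, l * (1 : ℕ) + gluingSign 4 ≠ c ∨ l * (2 : ℕ) + gluingSign 3 ≠ c ∨
          l * (3 : ℕ) + gluingSign 2 ≠ c := by decide
        intro l c
        have hsub : ∀ t, 5 + d - (d + t) = 5 - t := fun t => by omega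
        simp only [hsub]
        rcases this l c with h | h | h
        exacts [⟨1, le_rfl, by norm_num, h⟩, ⟨2, by norm_num, by norm_num, h⟩,
          ⟨3, by norm_num, le_rfl, h⟩] }
  refine hglued.mixed fun A hA => gluedColoring_compl hβ ?_ hf₁ hf₂ hA
  rw [card_disjSum, hW₁, hW₂]
  exact Odd.add_odd (by decide) hodd

end SumColoring

/-! ### Assembling the bounds -/

theorem satVC_le_of_odd {d n : ℕ} (hd : 3 ≤ d) (hodd : Odd d) (hn : 2 * d ≤ n) :
    satVC n (d - 1) ≤ (((2 * d).choose d / 2 : ℕ) : ℕ∞) := by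
  obtain ⟨f, hanti, hf⟩ := exists_mixed_of_odd hd hodd
  exact satVC_le_of_mixed (by omega) (by simp [mul_comm]) hn (fun A _ => hanti A) hf

/-- Gluing needs `d - 5` to be odd and at least 3; at `d = 6` it would be 1, so the table is used
instead. -/
theorem satVC_le_of_even {d n : ℕ} (hd : 6 ≤ d) (heven : Even d) (hn : 2 * d ≤ n) :
    satVC n (d - 1) ≤ (((2 * d).choose d / 2 : ℕ) : ℕ∞) := by
  obtain rfl | hd8 : d = 6 ∨ 8 ≤ d := by
    obtain ⟨m, rfl⟩ := heven
    omega
  · obtain ⟨f, hanti, hf⟩ := exists_mixed_six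
    exact satVC_le_of_mixed (by norm_num) (by simp) hn hanti hf
  · obtain ⟨e, rfl⟩ : ∃ e, d = 5 + e := ⟨d - 5, by omega⟩
    have hodd : Odd e := by
      obtain ⟨m, hm⟩ := heven
      exact ⟨m - 3, by omega⟩
    obtain ⟨f₁, hsymm, hf₁⟩ := exists_symmetric_mixed_five
    obtain ⟨f₂, hanti, hf₂⟩ := exists_mixed_of_odd (by omega) hodd
    have hcard : Fintype.card (Fin e × Bool) = 2 * e := by simp [mul_comm]
    obtain ⟨W₁, -, hW₁⟩ := Finset.exists_subset_card_eq (s := (Finset.univ : Finset (Fin 10)))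
      (n := 5) (by simp)
    obtain ⟨W₂, -, hW₂⟩ := Finset.exists_subset_card_eq
      (s := (Finset.univ : Finset (Fin e × Bool))) (n := e)
      (by rw [Finset.card_univ, hcard]; omega)
    refine satVC_le_of_mixed (α := Fin 10 ⊕ Fin e × Bool) (by omega)
      (by rw [Fintype.card_sum, hcard, Fintype.card_fin]; omega) hn
      (fun A hA => gluedColoring_compl (d := e) (by simp) ?_ hsymm (fun A _ => hanti A) hA)
      (mixed_gluedColoring (W₁ := W₁) (W₂ := W₂) (by simp) hcard (by omega) hodd hW₁ hW₂ hsymm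
        (fun A _ => hanti A) hf₁ hf₂)
    rw [Finset.card_disjSum, hW₁, hW₂]
    exact Odd.add_odd (by decide) hodd

theorem choose_two_mul_div_two_le (d : ℕ) :
    (((2 * d).choose d / 2 : ℕ) : ℕ∞) ≤ (4 : ℕ∞) ^ d := by
  have h : (2 * d).choose d / 2 ≤ 4 ^ d :=
    (Nat.div_le_self _ _).trans (by
      rw [show 4 = 2 ^ 2 from rfl, ← pow_mul]; exact Nat.choose_le_two_pow _ _)
  exact_mod_cast h

theorem theorem2 (d n : ℕ) (hd : 3 ≤ d) (hn : 2 * d ≤ n) :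
    satVC n (d - 1) ≤ (4 : ℕ∞) ^ d ∧
      (Odd d ∨ 14 ≤ d → satVC n (d - 1) ≤ (((2 * d).choose d / 2 : ℕ) : ℕ∞)) := by
  -- The binomial bound is obtained for every `d ≠ 4`, and `d = 4` is neither odd nor at least 14.
  obtain rfl | hd4 : d = 4 ∨ d ≠ 4 := em _
  · refine ⟨satVC_three_le (by omega), fun h => ?_⟩
    rcases h with h | h
    · exact absurd h (by decide)
    · omega
  · have key : satVC n (d - 1) ≤ (((2 * d).choose d / 2 : ℕ) : ℕ∞) := by
      rcases Nat.even_or_odd d with heven | hodd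
      · refine satVC_le_of_even ?_ heven hn
        obtain ⟨m, rfl⟩ := heven
        omega
      · exact satVC_le_of_odd hd hodd hn
    exact ⟨key.trans (choose_two_mul_div_two_le d), fun _ => key⟩
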